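/- **Theorem (Hodge-to-de Rham degeneration).** Let $\Sigma$ be a complete smooth fan in $N_{\mathbb R}=\mathbb R^n$, $N=\mathbb Z^n$, whose toric manifold is projective, i.e. there is a strictly convex piecewise linear function on $\Sigma$ with integral slopes. Let $\rho_1,\dots,\rho_d\in N$ be the primitive generators of its rays. Let $X\subset\mathbb C^d$ be the reduced analytic space defined by the equations $z_{i_1}\cdots z_{i_p}=0$, one for each primitive collection $\{\rho_{i_1},\dots,\rho_{i_p}\}$ (a set of rays that does not generate a cone of $\Sigma$ while each of its proper subsets does), with its ring $\mathcal O(X)$ of holomorphic functions, and let $f=z_1+\cdots+z_d$. Write $\theta_i=z_i\,\partial/\partial z_i$. The module $\Theta^1=\Theta^1_{X^\dagger/0^\dagger}$ of (global) relative log derivations consists of the $\sum_{i=1}^d b_i\theta_i$ with $b_i=\lambda(\rho_i)$ for some $\lambda\in\operatorname{Hom}_{\mathbb Z}(N,\mathcal O(X))$. It is free over $\mathcal O(X)$ with frame $\tilde\theta_j=\sum_{i=1}^d\langle\rho_i,e^j\rangle\theta_i$, $1\le j\le n$, where $e^1,\dots,e^n$ is the dual of the standard basis of $N$. Put $\Theta^k=\bigwedge^k_{\mathcal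 O(X)}\Theta^1$. Let $\partial/\partial\tilde\theta_j:\Theta^{k+1}\to\Theta^k$ be the contraction with the $j$-th element of the dual frame, let $\tilde\theta_j$ act on polyvector fields through their coefficients in the frame $\tilde\theta_{j_1}\wedge\cdots\wedge\tilde\theta_{j_k}$, and set $$\{f,-\}=\sum_{j=1}^n\tilde\theta_j(f)\,\frac{\partial}{\partial\tilde\theta_j},\qquad \partial=\sum_{j=1}^n\tilde\theta_j\circ\frac{\partial}{\partial\tilde\theta_j}:\ \Theta^{k+1}\to\Theta^k .$$ For a formal variable $u$ this gives a complex $(\Theta^\bullet[[u]],\{f,-\}+u\partial)$ of $\mathbb C[[u]]$-modules, filtered by the subcomplexes $u^p\Theta^\bullet[[u]]$. Then the spectral sequence of this ($u$-adic) filtration degenerates at the $E_1$ page: its differentials $d_r$ vanish for all $r\ge 1$. Moreover, in every degree $k$ there is an isomorphism of $\mathbb C[[u]]$-modules $$H^k(\Theta^\bullet[[u]],\{f,-\}+u\partial)\;\cong\;H^k(\Theta^\bullet,\{f,-\})[[u]]$$ under which the class of a cycle $\sum_i x_iu^i$ goes to a power series with constant term the class of $x_0$. -/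

import Mathlib

open PowerSeries

noncomputable section

/-! ## Formal power series with values in a module -/

/-- `A[[u]]`: formal power series in `u` with coefficients in the module `A`;
`x : FormalSeries A` stands for `∑ i, x i * u ^ i`. -/
def FormalSeries (A : Type*) : Type _ := ℕ → A

namespace FormalSeries

instance {A : Type*} [AddCommGroup A] : AddCommGroup (FormalSeries A) :=
  inferInstanceAs (AddCommGroup (ℕ → A))

theorem add_coeff {A : Type*} [AddCommGroup A] (x y : FormalSeries A) (m : ℕ) :
    (x + y) m = x m + y m := rfl

theorem zero_coeff {A : Type*} [AddCommGroup A] (m : ℕ) : (0 : FormalSeries A) m = 0 := rfl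

/-- The `R[[u]]`-module structure on `A[[u]]` given by the Cauchy product. -/
instance {R A : Type*} [CommRing R] [AddCommGroup A] [Module R A] :
    SMul R⟦X⟧ (FormalSeries A) where
  smul a x := fun m => ∑ p ∈ Finset.HasAntidiagonal.antidiagonal m, coeff p.1 a • x p.2

theorem smul_coeff {R A : Type*} [CommRing R] [AddCommGroup A] [Module R A]
    (a : R⟦X⟧) (x : FormalSeries A) (m : ℕ) :
    (a • x) m = ∑ p ∈ Finset.HasAntidiagonal.antidiagonal m, coeff p.1 a • x p.2 := rfl

instance {R A : Type*} [CommRing R] [AddCommGroup A] [Module R A] :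
    Module R⟦X⟧ (FormalSeries A) where
  one_smul x := by
    funext m
    rw [smul_coeff, Finset.sum_eq_single (0, m)]
    · simp
    · rintro ⟨i, j⟩ hij hne
      have : i ≠ 0 := by
        rintro rfl
        apply hne
        simpa using hij
      simp [coeff_one, this]
    · simp
  mul_smul a b x := by
    funext m
    simp only [smul_coeff, coeff_mul, Finset.sum_smul, Finset.smul_sum, smul_smul]
    rw [Finset.sum_sigma', Finset.sum_sigma']
    refine Finset.sum_nbij' (fun q => ⟨(q.2.1, q.2.2 + q.1.2), (q.2.2, q.1.2)⟩)
      (fun q => ⟨(q.1.1 + q.2.1, q.2.2), (q.1.1, q.2.1)⟩) ?_ ?_ ?_ ?_ ?_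
    · rintro ⟨⟨i, j⟩, ⟨k, l⟩⟩ h
      simp only [Finset.mem_sigma, Finset.HasAntidiagonal.mem_antidiagonal] at h ⊢
      exact ⟨by omega, trivial⟩
    · rintro ⟨⟨i, j⟩, ⟨k, l⟩⟩ h
      simp only [Finset.mem_sigma, Finset.HasAntidiagonal.mem_antidiagonal] at h ⊢
      exact ⟨by omega, trivial⟩
    · rintro ⟨⟨i, j⟩, ⟨k, l⟩⟩ h
      simp only [Finset.mem_sigma, Finset.HasAntidiagonal.mem_antidiagonal] at h
      obtain ⟨h1, rfl⟩ := h
      rfl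
    · rintro ⟨⟨i, j⟩, ⟨k, l⟩⟩ h
      simp only [Finset.mem_sigma, Finset.HasAntidiagonal.mem_antidiagonal] at h
      obtain ⟨h1, rfl⟩ := h
      rfl
    · rintro ⟨⟨i, j⟩, ⟨k, l⟩⟩ h
      rfl
  smul_zero a := by
    funext m
    simp [smul_coeff, zero_coeff]
  smul_add a x y := by
    funext m
    simp [smul_coeff, add_coeff, Finset.sum_add_distrib]
  add_smul a b x := by
    funext m
    simp [smul_coeff, add_coeff, add_smul, Finset.sum_add_distrib]
  zero_smul x := by
    funext m
    simp [smul_coeff, zero_coeff]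

/-- The coefficientwise extension `A[[u]] → B[[u]]` of a linear map `A → B`. -/
def map {R A B : Type*} [CommRing R] [AddCommGroup A] [Module R A] [AddCommGroup B] [Module R B]
    (φ : A →ₗ[R] B) : FormalSeries A →ₗ[R⟦X⟧] FormalSeries B where
  toFun x := fun m => φ (x m)
  map_add' x y := by
    funext m
    exact φ.map_add (x m) (y m)
  map_smul' a x := by
    funext m
    simp [smul_coeff]
    rfl

theorem map_coeff {R A B : Type*} [CommRing R] [AddCommGroup A] [Module R A] [AddCommGroup B]
    [Module R B] (φ : A →ₗ[R] B) (x : FormalSeries A) (m : ℕ) : map φ x m = φ (x m) := rfl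

end FormalSeries

/-! ## Filtered complexes and their spectral sequences -/

/-- A chain complex of `R`-modules with a decreasing filtration by subcomplexes. -/
structure FilteredComplex (R : Type) [CommRing R] where
  /-- the underlying complex -/
  C : ChainComplex (ModuleCat.{0} R) ℕ
  /-- the filtration `F p` in every degree -/
  F : ℤ → ∀ k : ℕ, Submodule R (C.X k)
  anti : ∀ p q : ℤ, p ≤ q → ∀ k, F q k ≤ F p k
  d_mem : ∀ (p : ℤ) (i j : ℕ) (x : C.X i), x ∈ F p i → (C.d i j).hom x ∈ F p j

namespace FilteredComplex

variable {R : Type} [CommRing R] (K : FilteredComplex R)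

/-- `Z_r^p = {x ∈ F^p : d x ∈ F^{p+r}}` in degree `k`. -/
def Z (r p : ℤ) (k : ℕ) : Submodule R (K.C.X k) :=
  K.F p k ⊓ ⨅ j : ℕ, (K.F (p + r) j).comap (K.C.d k j).hom

/-- `Z_{r-1}^{p+1} + d Z_{r-1}^{p-r+1}` in degree `k`. -/
def B (r p : ℤ) (k : ℕ) : Submodule R (K.C.X k) :=
  K.Z (r - 1) (p + 1) k ⊔ ⨆ i : ℕ, (K.Z (r - 1) (p - r + 1) i).map (K.C.d i k).hom

/-- The term `E_r^p = Z_r^p / (Z_{r-1}^{p+1} + d Z_{r-1}^{p-r+1})` of total degree `k` of the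
spectral sequence of the filtered complex. -/
abbrev E (r p : ℤ) (k : ℕ) : Type := K.Z r p k ⧸ (K.B r p k).submoduleOf (K.Z r p k)

theorem d_d (i j l : ℕ) (x : K.C.X i) : (K.C.d j l).hom ((K.C.d i j).hom x) = 0 := by
  have h := K.C.d_comp_d i j l
  exact congrArg (fun φ => φ.hom x) h

theorem d_mem_Z (r p : ℤ) (i j : ℕ) (x : K.C.X i) (hx : x ∈ K.Z r p i) :
    (K.C.d i j).hom x ∈ K.Z r (p + r) j := by
  refine ⟨(Submodule.mem_iInf _).1 hx.2 j, (Submodule.mem_iInf _).2 fun l => ?_⟩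
  rw [Submodule.mem_comap, d_d]
  exact zero_mem _

theorem d_mem_B (r p : ℤ) (i j : ℕ) (x : K.C.X i) (hx : x ∈ K.B r p i) :
    (K.C.d i j).hom x ∈ K.B r (p + r) j := by
  have key : K.B r p i ≤ (K.B r (p + r) j).comap (K.C.d i j).hom := by
    refine sup_le ?_ (iSup_le fun l => ?_)
    · intro y hy
      refine Submodule.mem_sup_right (Submodule.mem_iSup_of_mem i ⟨y, ?_, rfl⟩)
      have : p + r - r + 1 = p + 1 := by ring
      rw [this]
      exact hy
    · rintro _ ⟨y, -, rfl⟩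
      rw [Submodule.mem_comap, d_d]
      exact zero_mem _
  exact key hx

/-- The differential `d_r : E_r^p → E_r^{p+r}` induced by the differential of the complex. -/
def dE (r p : ℤ) (i j : ℕ) : K.E r p i →ₗ[R] K.E r (p + r) j :=
  Submodule.mapQ _ _
    ((K.C.d i j).hom.restrict (p := K.Z r p i) (q := K.Z r (p + r) j) (K.d_mem_Z r p i j))
    fun x hx => K.d_mem_B r p i j x hx

/-- The spectral sequence degenerates at `E_{r₀}`: all differentials `d_r` with `r ≥ r₀` vanish. -/
def DegeneratesAt (r₀ : ℤ) : Prop :=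
  ∀ r : ℤ, r₀ ≤ r → ∀ (p : ℤ) (i j : ℕ), K.dE r p i j = 0

end FilteredComplex

/-- The `u`-adic filtration `F^p = u^p C` (with `F^p = C` for `p ≤ 0`) on a complex `C` of
modules over `R[[u]]`. -/
def uAdicFiltration {R : Type} [CommRing R] (C : ChainComplex (ModuleCat.{0} R⟦X⟧) ℕ) :
    FilteredComplex R⟦X⟧ where
  C := C
  F p k := LinearMap.range (LinearMap.lsmul R⟦X⟧ (C.X k) (X ^ p.toNat))
  anti p q hpq k := by
    rintro _ ⟨y, rfl⟩
    refine ⟨(X : R⟦X⟧) ^ (q.toNat - p.toNat) • y, ?_⟩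
    have : p.toNat + (q.toNat - p.toNat) = q.toNat := by omega
    simp only [LinearMap.lsmul_apply, smul_smul]
    rw [← pow_add, this]
  d_mem p i j := by
    rintro _ ⟨y, rfl⟩
    exact ⟨(C.d i j).hom y, by simp⟩

/-! ## Smooth fans -/

/-- The cone in `ℝ^n` generated by the vectors `ρ i`, `i ∈ σ`. -/
def latticeCone {n d : ℕ} (ρ : Fin d → Fin n → ℤ) (σ : Finset (Fin d)) : Set (Fin n → ℝ) :=
  {x | ∃ c : Fin d → ℝ, (∀ i, 0 ≤ c i) ∧ (∀ i ∉ σ, c i = 0) ∧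
    ∀ j, x j = ∑ i, c i * (ρ i j : ℝ)}

/-- A smooth fan in `ℝ^n = N ⊗ ℝ`, `N = ℤ^n`, with `d` rays. Every cone of a smooth fan is
generated by part of a `ℤ`-basis of `N`, so that it is recorded by its set of rays, and its faces
are generated by the subsets of this set. -/
structure SmoothFan (n d : ℕ) where
  /-- the primitive generators `ρ_1, …, ρ_d` of the rays -/
  ray : Fin d → Fin n → ℤ
  /-- the sets of rays that generate a cone of the fan -/
  cones : Set (Finset (Fin d))
  face_mem : ∀ σ ∈ cones, ∀ τ ⊆ σ, τ ∈ cones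
  ray_mem : ∀ i, {i} ∈ cones
  smooth : ∀ σ ∈ cones, ∃ (b : Module.Basis (Fin n) ℤ (Fin n → ℤ)) (e : σ ↪ Fin n),
    ∀ i : σ, b (e i) = ray i
  /-- two cones intersect in their common face -/
  inter : ∀ σ ∈ cones, ∀ τ ∈ cones,
    latticeCone ray σ ∩ latticeCone ray τ = latticeCone ray (σ ∩ τ)

namespace SmoothFan

variable {n d : ℕ} (S : SmoothFan n d)

/-- The fan is complete: its cones cover `ℝ^n`. -/
def IsComplete : Prop := ∀ x : Fin n → ℝ, ∃ σ ∈ S.cones, x ∈ latticeCone S.ray σ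

/-- There is a strictly convex piecewise linear function `ψ` with integral slopes: on every
`n`-dimensional cone `ψ` is a linear form `m ∈ Hom(N, ℤ)`, and `ψ > m` off that cone. For a complete
fan this says that the toric manifold is projective. -/
def IsProjective : Prop :=
  ∃ ψ : (Fin n → ℝ) → ℝ, ∀ σ ∈ S.cones, σ.card = n → ∃ m : Fin n → ℤ,
    (∀ x ∈ latticeCone S.ray σ, ψ x = ∑ j, (m j : ℝ) * x j) ∧
    (∀ x ∉ latticeCone S.ray σ, ∑ j, (m j : ℝ) * x j < ψ x)

/-- A primitive collection: a set of rays that does not generate a cone of the fan, while every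
proper subset does. -/
def IsPrimitiveCollection (P : Finset (Fin d)) : Prop :=
  P ∉ S.cones ∧ ∀ Q, Q ⊂ P → Q ∈ S.cones

/-! ## The space `X` and its holomorphic functions -/

/-- The central fibre `X ⊆ ℂ^d`: the zero set of the monomials `∏_{i ∈ P} z_i`, `P` a primitive
collection, which generate the (radical) Stanley-Reisner ideal. -/
def space : Set (Fin d → ℂ) :=
  {z | ∀ P, S.IsPrimitiveCollection P → ∏ i ∈ P, z i = 0}

/-- `F` is holomorphic near `x ∈ X` and restricts to `h` on a neighbourhood of `x` in `X`. -/
def IsLocalExtension (h : S.space → ℂ) (x : S.space) (F : (Fin d → ℂ) → ℂ) : Prop :=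
  AnalyticAt ℂ F x ∧ ∀ᶠ y in nhds (x : Fin d → ℂ), ∀ hy : y ∈ S.space, h ⟨y, hy⟩ = F y

/-- The algebra `𝒪(X)` of holomorphic functions on the reduced analytic space `X`: the functions
that are locally restrictions of holomorphic functions on open subsets of `ℂ^d`. -/
def hol : Subalgebra ℂ (S.space → ℂ) where
  carrier := {h | ∀ x, ∃ F, S.IsLocalExtension h x F}
  mul_mem' := by
    intro a b ha hb x
    obtain ⟨F, hF, hF2⟩ := ha x
    obtain ⟨G, hG, hG2⟩ := hb x
    refine ⟨F * G, hF.mul hG, ?_⟩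
    filter_upwards [hF2, hG2] with y h1 h2 hy
    simp [h1 hy, h2 hy]
  add_mem' := by
    intro a b ha hb x
    obtain ⟨F, hF, hF2⟩ := ha x
    obtain ⟨G, hG, hG2⟩ := hb x
    refine ⟨F + G, hF.add hG, ?_⟩
    filter_upwards [hF2, hG2] with y h1 h2 hy
    simp [h1 hy, h2 hy]
  algebraMap_mem' := by
    intro r x
    exact ⟨fun _ => r, analyticAt_const, Filter.Eventually.of_forall fun y hy => rfl⟩

theorem update_mem_space (i : Fin d) (t : ℂ) (x : S.space) :
    Function.update (x : Fin d → ℂ) i (t * (x : Fin d → ℂ) i) ∈ S.space := by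
  intro P hP
  obtain ⟨j, hj, h0⟩ := Finset.prod_eq_zero_iff.1 (x.2 P hP)
  refine Finset.prod_eq_zero hj ?_
  by_cases hij : j = i
  · subst hij
    simp [h0]
  · simp [Function.update_of_ne hij, h0]

/-- Multiplication of the `i`-th coordinate by `t`, as a map `X → X`. -/
def scale (i : Fin d) (t : ℂ) (x : S.space) : S.space :=
  ⟨Function.update (x : Fin d → ℂ) i (t * (x : Fin d → ℂ) i), S.update_mem_space i t x⟩

/-- `θ_i h = z_i ∂h/∂z_i`, the derivative of `h` along the scaling of the `i`-th coordinate. -/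
def eulerFun (i : Fin d) (h : S.space → ℂ) (x : S.space) : ℂ :=
  deriv (fun t : ℂ => h (S.scale i t x)) 1

theorem eulerFun_eq (i : Fin d) {h : S.space → ℂ} {x : S.space} {F : (Fin d → ℂ) → ℂ}
    (hF : S.IsLocalExtension h x F) :
    S.eulerFun i h x = (x : Fin d → ℂ) i * fderiv ℂ F x (Pi.single i 1) := by
  set γ : ℂ → (Fin d → ℂ) := fun t =>
    (x : Fin d → ℂ) + (t - 1) • ((x : Fin d → ℂ) i • Pi.single i (1 : ℂ)) with hγ
  have hγeq : ∀ t, ((S.scale i t x : S.space) : Fin d → ℂ) = γ t := by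
    intro t
    funext j
    by_cases hij : j = i
    · subst hij
      simp [scale, hγ]
      ring
    · simp [scale, hγ, hij]
  have hγ1 : γ 1 = x := by simp [hγ]
  have hγd : HasDerivAt γ ((x : Fin d → ℂ) i • Pi.single i (1 : ℂ)) 1 := by
    have h1 : HasDerivAt (fun t : ℂ => t - 1) 1 1 := (hasDerivAt_id (1 : ℂ)).sub_const 1
    have := (h1.smul_const ((x : Fin d → ℂ) i • (Pi.single i (1 : ℂ) : Fin d → ℂ))).const_add
      (x : Fin d → ℂ)
    simpa only [one_smul] using this
  have hev : (fun t : ℂ => h (S.scale i t x)) =ᶠ[nhds 1] fun t => F (γ t) := by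
    have hc : Filter.Tendsto γ (nhds 1) (nhds (x : Fin d → ℂ)) := by
      have := hγd.continuousAt.tendsto
      rwa [hγ1] at this
    filter_upwards [hc.eventually hF.2] with t ht
    have hm : γ t ∈ S.space := hγeq t ▸ (S.scale i t x).2
    rw [← ht hm]
    congr 1
    exact Subtype.ext (hγeq t)
  rw [eulerFun, hev.deriv_eq]
  have hFd : HasFDerivAt F (fderiv ℂ F x) (γ 1) := by
    rw [hγ1]
    exact hF.1.differentiableAt.hasFDerivAt
  have := (hFd.comp_hasDerivAt 1 hγd).deriv
  rw [Function.comp_def] at this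
  rw [this]
  simp

theorem isLocalExtension_eulerFun (i : Fin d) {h : S.space → ℂ} {x : S.space}
    {F : (Fin d → ℂ) → ℂ} (hF : S.IsLocalExtension h x F) :
    S.IsLocalExtension (S.eulerFun i h) x (fun y => y i * fderiv ℂ F y (Pi.single i 1)) := by
  refine ⟨?_, ?_⟩
  · have h1 : AnalyticAt ℂ (fun y : Fin d → ℂ => y i) (x : Fin d → ℂ) :=
      (ContinuousLinearMap.proj (R := ℂ) (φ := fun _ : Fin d => ℂ) i).analyticAt _
    have h2 : AnalyticAt ℂ (fun y => fderiv ℂ F y (Pi.single i 1)) (x : Fin d → ℂ) :=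
      ((ContinuousLinearMap.apply ℂ ℂ (Pi.single i (1 : ℂ) : Fin d → ℂ)).analyticAt _).comp
        hF.1.fderiv
    exact h1.mul h2
  · filter_upwards [hF.1.eventually_analyticAt, eventually_eventually_nhds.2 hF.2] with y h1 h2 hy
    exact S.eulerFun_eq i (x := ⟨y, hy⟩) ⟨h1, h2⟩

/-- The derivation `θ_i = z_i ∂/∂z_i` of `𝒪(X)`. -/
def euler (i : Fin d) : Derivation ℂ S.hol S.hol :=
  Derivation.mk'
    { toFun := fun h => ⟨S.eulerFun i h, fun x => by
        obtain ⟨F, hF⟩ := h.2 x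
        exact ⟨_, S.isLocalExtension_eulerFun i hF⟩⟩
      map_add' := by
        intro a b
        refine Subtype.ext (funext fun x => ?_)
        obtain ⟨F, hF⟩ := a.2 x
        obtain ⟨G, hG⟩ := b.2 x
        have hFG : S.IsLocalExtension ((a + b : S.hol) : S.space → ℂ) x (F + G) := by
          refine ⟨hF.1.add hG.1, ?_⟩
          filter_upwards [hF.2, hG.2] with y h1 h2 hy
          simp [h1 hy, h2 hy]
        change S.eulerFun i _ x = S.eulerFun i a x + S.eulerFun i b x
        rw [S.eulerFun_eq i hF, S.eulerFun_eq i hG, S.eulerFun_eq i hFG,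
          fderiv_add hF.1.differentiableAt hG.1.differentiableAt]
        simp [mul_add]
      map_smul' := by
        intro c a
        refine Subtype.ext (funext fun x => ?_)
        obtain ⟨F, hF⟩ := a.2 x
        have hcF : S.IsLocalExtension ((c • a : S.hol) : S.space → ℂ) x (c • F) := by
          refine ⟨hF.1.const_smul, ?_⟩
          filter_upwards [hF.2] with y h1 hy
          simp [h1 hy]
        change S.eulerFun i _ x = c * S.eulerFun i a x
        rw [S.eulerFun_eq i hF, S.eulerFun_eq i hcF,
          fderiv_const_smul hF.1.differentiableAt]
        simp
        ring }
    (by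
      intro a b
      refine Subtype.ext (funext fun x => ?_)
      obtain ⟨F, hF⟩ := a.2 x
      obtain ⟨G, hG⟩ := b.2 x
      have hFG : S.IsLocalExtension ((a * b : S.hol) : S.space → ℂ) x (F * G) := by
        refine ⟨hF.1.mul hG.1, ?_⟩
        filter_upwards [hF.2, hG.2] with y h1 h2 hy
        simp [h1 hy, h2 hy]
      change S.eulerFun i _ x = (a : S.space → ℂ) x * S.eulerFun i b x
        + (b : S.space → ℂ) x * S.eulerFun i a x
      have ha : (a : S.space → ℂ) x = F x := hF.2.self_of_nhds x.2
      have hb : (b : S.space → ℂ) x = G x := hG.2.self_of_nhds x.2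
      rw [S.eulerFun_eq i hF, S.eulerFun_eq i hG, S.eulerFun_eq i hFG,
        fderiv_mul hF.1.differentiableAt hG.1.differentiableAt, ha, hb]
      simp
      ring)

theorem euler_apply (i : Fin d) (h : S.hol) (x : S.space) :
    (S.euler i h : S.space → ℂ) x = S.eulerFun i h x := rfl

theorem euler_comm (i k : Fin d) (h : S.hol) :
    S.euler i (S.euler k h) = S.euler k (S.euler i h) := by
  refine Subtype.ext (funext fun x => ?_)
  obtain ⟨F, hF⟩ := h.2 x
  have hD : DifferentiableAt ℂ (fderiv ℂ F) (x : Fin d → ℂ) := hF.1.fderiv.differentiableAt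
  have key : ∀ a b : Fin d, S.eulerFun a (S.eulerFun b h) x =
      (x : Fin d → ℂ) a * ((x : Fin d → ℂ) b *
        fderiv ℂ (fderiv ℂ F) x (Pi.single a 1) (Pi.single b 1)) +
      (x : Fin d → ℂ) a * ((Pi.single a (1 : ℂ) : Fin d → ℂ) b *
        fderiv ℂ F x (Pi.single b 1)) := by
    intro a b
    rw [S.eulerFun_eq a (S.isLocalExtension_eulerFun b hF)]
    have h1 : HasFDerivAt (fun y : Fin d → ℂ => y b)
        (ContinuousLinearMap.proj (R := ℂ) (φ := fun _ : Fin d => ℂ) b) (x : Fin d → ℂ) :=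
      (ContinuousLinearMap.proj (R := ℂ) (φ := fun _ : Fin d => ℂ) b).hasFDerivAt
    have h2 : HasFDerivAt (fun y => fderiv ℂ F y (Pi.single b (1 : ℂ)))
        ((ContinuousLinearMap.apply ℂ ℂ (Pi.single b (1 : ℂ) : Fin d → ℂ)).comp
          (fderiv ℂ (fderiv ℂ F) x)) (x : Fin d → ℂ) :=
      ((ContinuousLinearMap.apply ℂ ℂ (Pi.single b (1 : ℂ) : Fin d → ℂ)).hasFDerivAt).comp
        (x : Fin d → ℂ) hD.hasFDerivAt
    rw [show (fun y : Fin d → ℂ => y b * fderiv ℂ F y (Pi.single b 1)) =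
      (fun y : Fin d → ℂ => y b) * fun y => fderiv ℂ F y (Pi.single b 1) from rfl,
      (h1.mul h2).fderiv]
    simp
    ring
  have hsymm : fderiv ℂ (fderiv ℂ F) x (Pi.single i 1) (Pi.single k 1) =
      fderiv ℂ (fderiv ℂ F) x (Pi.single k 1) (Pi.single i 1) :=
    (hF.1.contDiffAt (n := ⊤)).isSymmSndFDerivAt (by simp) _ _
  change S.eulerFun i (S.eulerFun k h) x = S.eulerFun k (S.eulerFun i h) x
  rw [key, key, hsymm]
  by_cases hik : i = k
  · subst hik
    rfl
  · simp [hik, Ne.symm hik]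
    ring

/-- The coordinate function `z_i` on `X`. -/
def coord (i : Fin d) : S.hol :=
  ⟨fun x => (x : Fin d → ℂ) i, fun _ => ⟨fun y => y i,
    (ContinuousLinearMap.proj (R := ℂ) (φ := fun _ : Fin d => ℂ) i).analyticAt _,
    Filter.Eventually.of_forall fun _ _ => rfl⟩⟩

/-- The superpotential `f = z_1 + ⋯ + z_d`. -/
def superpotential : S.hol := ∑ i, S.coord i

/-! ## Relative logarithmic polyvector fields -/

/-- The global frame `θ̃_j = ∑_i ⟨ρ_i, e^j⟩ θ_i`, `1 ≤ j ≤ n`, of the relative log derivations of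
`X^† / 0^†`, acting on `𝒪(X)`; it is dual to the basis `e_1, …, e_n` of `N`. -/
def frame (j : Fin n) : Derivation ℂ S.hol S.hol := ∑ i, S.ray i j • S.euler i

theorem frame_apply (j : Fin n) (h : S.hol) : S.frame j h = ∑ i, S.ray i j • S.euler i h := by
  have : S.frame j h = Derivation.coeFnAddMonoidHom (S.frame j) h := rfl
  rw [this, frame, map_sum, Finset.sum_apply]
  rfl

theorem frame_comm (j k : Fin n) (h : S.hol) :
    S.frame j (S.frame k h) = S.frame k (S.frame j h) := by
  simp only [frame_apply, map_sum, map_zsmul, Finset.smul_sum]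
  rw [Finset.sum_comm]
  refine Finset.sum_congr rfl fun i _ => Finset.sum_congr rfl fun l _ => ?_
  rw [S.euler_comm, smul_comm]

/-- The global sections `Θ^k` of the `k`-th exterior power of the relative log derivations of
`X^† / 0^†`.

A relative log derivation `∑_i b_i θ_i` of `X^† / 0^†` has coefficients `b_i ∈ 𝒪(X)` that satisfy all
linear relations between the `ρ_i`, i.e. `b_i = λ(ρ_i)` for a unique `λ ∈ Hom(N, 𝒪(X))` (the value of
the derivation on `dlog` of the monomials). As `N` is free of finite rank,
`⋀^k Hom(N, 𝒪(X))` is the module of alternating `k`-forms on `N` with values in `𝒪(X)`, where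
`λ_1 ∧ ⋯ ∧ λ_k` is the form `(v_1, …, v_k) ↦ det (λ_i (v_j))`. In the frame `θ̃_1, …, θ̃_n` the
coefficient of `θ̃_{j_1} ∧ ⋯ ∧ θ̃_{j_k}` in `α` is `α (e_{j_1}, …, e_{j_k})`. -/
abbrev PolyVector (k : ℕ) : Type := (Fin n → ℤ) [⋀^Fin k]→ₗ[ℤ] S.hol

theorem sum_polyVector_apply {ι : Type*} (s : Finset ι) {k : ℕ} (α : ι → S.PolyVector k)
    (v : Fin k → Fin n → ℤ) : (∑ i ∈ s, α i) v = ∑ i ∈ s, α i v := by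
  classical
  induction s using Finset.induction_on with
  | empty => simp
  | insert i s hi ih => rw [Finset.sum_insert hi, Finset.sum_insert hi, AlternatingMap.add_apply, ih]

variable {S} in
/-- `∂/∂θ̃_j`: contraction with the log form `dlog` of the `j`-th basis vector of `N`. -/
def contract {k : ℕ} (j : Fin n) (α : S.PolyVector (k + 1)) : S.PolyVector k :=
  α.curryLeft (Pi.single j 1)

variable {S} in
theorem contract_contract {k : ℕ} (i j : Fin n) (α : S.PolyVector (k + 2)) :
    contract i (contract j α) = - contract j (contract i α) := by
  have h0 := α.curryLeft_same (Pi.single i 1 + Pi.single j 1)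
  have h1 := α.curryLeft_same (Pi.single i 1)
  have h2 := α.curryLeft_same (Pi.single j 1)
  simp only [map_add, AlternatingMap.curryLeft_add, LinearMap.add_apply] at h0
  rw [h1, h2, zero_add, add_zero] at h0
  rw [eq_neg_iff_add_eq_zero, add_comm]
  first
    | exact h0
    | (rw [add_comm]; exact h0)

/-- The differential `{h, -} : Θ^{k+1} → Θ^k`, contraction with
`dh = ∑_j θ̃_j(h) dlog(e_j)`, so that `{h, -} = ∑_j θ̃_j(h) ∂/∂θ̃_j`. Contraction with the volume form
`Ω = dlog(e_1) ∧ ⋯ ∧ dlog(e_n)` turns it into `dh ∧ -`, up to a sign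
that depends only on the degree. -/
def bracket (h : S.hol) (k : ℕ) : S.PolyVector (k + 1) →ₗ[ℂ] S.PolyVector k where
  toFun α := ∑ j, S.frame j h • contract j α
  map_add' α β := by
    simp [contract, AlternatingMap.curryLeft_add, Finset.sum_add_distrib]
  map_smul' c α := by
    simp only [Finset.smul_sum, RingHom.id_apply]
    refine Finset.sum_congr rfl fun j _ => ?_
    rw [smul_comm]
    rfl

theorem bracket_apply (h : S.hol) (k : ℕ) (α : S.PolyVector (k + 1)) (v : Fin k → Fin n → ℤ) :
    S.bracket h k α v = ∑ j, S.frame j h * contract j α v := by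
  change (∑ j, S.frame j h • contract j α) v = _
  rw [sum_polyVector_apply]
  rfl

/-- The action of `θ̃_j` on the coefficients of a polyvector field. -/
def frameCoeff (j : Fin n) {k : ℕ} (α : S.PolyVector k) : S.PolyVector k :=
  ((S.frame j : S.hol →ₗ[ℂ] S.hol).restrictScalars ℤ).compAlternatingMap α

theorem frameCoeff_apply (j : Fin n) {k : ℕ} (α : S.PolyVector k) (v : Fin k → Fin n → ℤ) :
    S.frameCoeff j α v = S.frame j (α v) := rfl

/-- The differential `∂ : Θ^{k+1} → Θ^k`, `∂ = ∑_j θ̃_j ∂/∂θ̃_j`, which contraction with `Ω` turns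
into the de Rham differential of log forms, up to the same sign as for the bracket. -/
def bv (k : ℕ) : S.PolyVector (k + 1) →ₗ[ℂ] S.PolyVector k where
  toFun α := ∑ j, S.frameCoeff j (contract j α)
  map_add' α β := by
    rw [← Finset.sum_add_distrib]
    refine Finset.sum_congr rfl fun j _ => ?_
    ext1 v
    exact (S.frame j).map_add _ _
  map_smul' c α := by
    simp only [Finset.smul_sum, RingHom.id_apply]
    refine Finset.sum_congr rfl fun j _ => ?_
    ext1 v
    exact (S.frame j).map_smul c _

theorem bv_apply (k : ℕ) (α : S.PolyVector (k + 1)) (v : Fin k → Fin n → ℤ) :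
    S.bv k α v = ∑ j, S.frame j (contract j α v) := by
  change (∑ j, S.frameCoeff j (contract j α)) v = _
  rw [sum_polyVector_apply]
  rfl

theorem contract_bracket (h : S.hol) (k : ℕ) (i : Fin n) (α : S.PolyVector (k + 2)) :
    contract i (S.bracket h (k + 1) α) = ∑ j, S.frame j h • contract i (contract j α) := by
  ext1 v
  change S.bracket h (k + 1) α _ = _
  rw [bracket_apply, sum_polyVector_apply]
  rfl

theorem contract_bv (k : ℕ) (i : Fin n) (α : S.PolyVector (k + 2)) :
    contract i (S.bv (k + 1) α) = ∑ j, S.frameCoeff j (contract i (contract j α)) := by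
  ext1 v
  change S.bv (k + 1) α _ = _
  rw [bv_apply, sum_polyVector_apply]
  rfl

theorem sum_eq_zero_of_antisymm (t : Fin n → Fin n → S.hol) (h : ∀ i j, t i j = - t j i) :
    ∑ i, ∑ j, t i j = 0 := by
  have h1 : ∑ i, ∑ j, t i j = - ∑ i, ∑ j, t i j := by
    conv_rhs => rw [Finset.sum_comm]
    rw [← Finset.sum_neg_distrib]
    refine Finset.sum_congr rfl fun i _ => ?_
    rw [← Finset.sum_neg_distrib]
    exact Finset.sum_congr rfl fun j _ => h i j
  have h2 : (2 : ℂ) • ∑ i, ∑ j, t i j = 0 := by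
    rw [two_smul]
    exact eq_neg_iff_add_eq_zero.1 h1
  exact (smul_eq_zero.1 h2).resolve_left two_ne_zero

theorem contract_contract_apply {k : ℕ} (i j : Fin n) (α : S.PolyVector (k + 2))
    (v : Fin k → Fin n → ℤ) :
    contract i (contract j α) v = - contract j (contract i α) v := by
  rw [contract_contract]
  rfl

theorem bracket_bracket (h : S.hol) (k : ℕ) (α : S.PolyVector (k + 2)) :
    S.bracket h k (S.bracket h (k + 1) α) = 0 := by
  ext1 v
  rw [bracket_apply]
  simp only [contract_bracket, sum_polyVector_apply, AlternatingMap.smul_apply, smul_eq_mul,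
    Finset.mul_sum]
  refine S.sum_eq_zero_of_antisymm _ fun i j => ?_
  rw [contract_contract_apply]
  ring

theorem bv_bv (k : ℕ) (α : S.PolyVector (k + 2)) : S.bv k (S.bv (k + 1) α) = 0 := by
  ext1 v
  rw [bv_apply]
  simp only [contract_bv, sum_polyVector_apply, frameCoeff_apply, map_sum]
  refine S.sum_eq_zero_of_antisymm _ fun i j => ?_
  rw [contract_contract_apply, map_neg, map_neg, S.frame_comm]

theorem bracket_bv (h : S.hol) (k : ℕ) (α : S.PolyVector (k + 2)) :
    S.bracket h k (S.bv (k + 1) α) + S.bv k (S.bracket h (k + 1) α) = 0 := by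
  ext1 v
  rw [AlternatingMap.add_apply, bracket_apply, bv_apply]
  simp only [contract_bracket, contract_bv, sum_polyVector_apply, AlternatingMap.smul_apply,
    frameCoeff_apply, smul_eq_mul, Finset.mul_sum, map_sum, Derivation.leibniz,
    Finset.sum_add_distrib]
  have h1 : ∑ i, ∑ j, contract i (contract j α) v * S.frame i (S.frame j h) = 0 := by
    refine S.sum_eq_zero_of_antisymm _ fun i j => ?_
    rw [contract_contract_apply, S.frame_comm]
    ring
  rw [h1, add_zero]
  conv_lhs =>
    enter [2]
    rw [Finset.sum_comm]
  rw [← Finset.sum_add_distrib]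
  refine Finset.sum_eq_zero fun i _ => ?_
  rw [← Finset.sum_add_distrib]
  refine Finset.sum_eq_zero fun j _ => ?_
  rw [contract_contract_apply, map_neg]
  ring

/-- The complex `(Θ^•, {f, -})`, with `Θ^k` in homological degree `k`. -/
def thetaComplex : ChainComplex (ModuleCat.{0} ℂ) ℕ :=
  ChainComplex.of (fun k => ModuleCat.of ℂ (S.PolyVector k))
    (fun k => ModuleCat.ofHom (S.bracket S.superpotential k))
    (fun k => by
      ext α : 2
      exact S.bracket_bracket S.superpotential k α)

/-- The differential `{f, -} + u ∂ : Θ^{k+1}[[u]] → Θ^k[[u]]`. -/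
def twistedD (k : ℕ) :
    FormalSeries (S.PolyVector (k + 1)) →ₗ[ℂ⟦X⟧] FormalSeries (S.PolyVector k) :=
  FormalSeries.map (S.bracket S.superpotential k) + (X : ℂ⟦X⟧) • FormalSeries.map (S.bv k)

theorem twistedD_twistedD (k : ℕ) (α : FormalSeries (S.PolyVector (k + 2))) :
    S.twistedD k (S.twistedD (k + 1) α) = 0 := by
  have h1 : FormalSeries.map (S.bracket S.superpotential k)
      (FormalSeries.map (S.bracket S.superpotential (k + 1)) α) = 0 :=
    funext fun m => S.bracket_bracket _ k (α m)
  have h2 : FormalSeries.map (S.bv k) (FormalSeries.map (S.bv (k + 1)) α) = 0 :=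
    funext fun m => S.bv_bv k (α m)
  have h3 : FormalSeries.map (S.bracket S.superpotential k) (FormalSeries.map (S.bv (k + 1)) α) +
      FormalSeries.map (S.bv k) (FormalSeries.map (S.bracket S.superpotential (k + 1)) α) = 0 :=
    funext fun m => S.bracket_bv _ k (α m)
  simp only [twistedD, LinearMap.add_apply, LinearMap.smul_apply, map_add, map_smul]
  rw [h1, h2, zero_add, smul_zero, add_zero, ← smul_add, add_comm, h3, smul_zero]

/-- The complex `(Θ^•[[u]], {f, -} + u ∂)` of `ℂ[[u]]`-modules, with `Θ^k[[u]]` in homological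
degree `k`. -/
def twistedComplex : ChainComplex (ModuleCat.{0} ℂ⟦X⟧) ℕ :=
  ChainComplex.of (fun k => ModuleCat.of ℂ⟦X⟧ (FormalSeries (S.PolyVector k)))
    (fun k => ModuleCat.ofHom (S.twistedD k))
    (fun k => by
      ext α : 2
      exact S.twistedD_twistedD k α)

/-- The constant coefficient `Θ^k[[u]] → Θ^k`, `u ↦ 0`. -/
def constantTerm (k : ℕ) (x : S.twistedComplex.X k) : S.thetaComplex.X k :=
  (show FormalSeries (S.PolyVector k) from x) 0

end SmoothFan

end

/-! Everything follows from one fact: `(Θ^•, {f, -})` is exact in positive degrees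
(`exists_bracket_eq`). Since `θ_i f = z_i`, the bracket is the Koszul operator `∑_i z_i ι_{ρ_i}` on
alternating forms with values in `𝒪(X)` (`bracket_superpotential`), that is, the Koszul complex of
the `n` linear functions `θ̃_j(f)`. Its exactness is an analytic counterpart of the fact that the
Stanley-Reisner ring of a shellable complex is Cohen-Macaulay.

The space `X` is the union of the coordinate spaces `ℂ^σ` of the maximal cones. On a single `ℂ^σ`
the rays of `σ` form a basis of `N`, and the operator is the Koszul differential of the coordinates;
it is exact because entire functions can be divided by coordinates (`Koszul.exists_diff_eq`).
Projectivity gives a shelling (`exists_shelling`): order the maximal cones by the value at a generic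
vector `v` of the linear pieces of the support function. Then `ℂ^σ` meets the union of the earlier
spaces in the zero set of the monomial `∏_{i ∈ τ} z_i`, where `τ` is the set of rays of `σ` on which
`v` has a negative coordinate. A cycle that vanishes on the earlier spaces is therefore, on `ℂ^σ`,
this monomial times a cycle, hence the monomial times a boundary. Pulled back to `X`, the primitive
still vanishes on the earlier spaces because it keeps the monomial as a factor
(`exists_restrictCone_sub_diff_eq_zero`). Correcting cone by cone makes the cycle exact.

The rest is formal. If the differential of a series of positive degree has zero constant term, then
the constant term of the series is a bracket cycle, hence a bracket boundary, so the series is a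
multiple of `u` modulo boundaries. This kills every `d_r` with `r ≥ 1`. In positive degrees both
homologies vanish. In degree zero a linear section of `Θ^0 → H_0` induces the isomorphism, with both
bijectivity statements proved coefficient by coefficient in `u`. -/

noncomputable section

open CategoryTheory
open scoped Topology

/-! ## Division of entire functions by coordinates -/

/-- The series of the difference quotient `(F y - F (y - l y • e)) / l y`, where `p` is the series
of `F` and `P y = y - l y • e`. -/
def FormalMultilinearSeries.divSeries {E : Type*} [NormedAddCommGroup E] [NormedSpace ℂ E]
    (p : FormalMultilinearSeries ℂ E ℂ) (P : E →L[ℂ] E) (e : E) :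
    FormalMultilinearSeries ℂ E ℂ := fun n =>
  ∑ k : Fin (n + 1), ((p (n + 1)).curryMid k e).compContinuousLinearMap
    fun i => if k.succAbove i < k then ContinuousLinearMap.id ℂ E else P

/-- The difference telescopes by replacing the arguments `y` with `P y` one slot at a time. The slot
being changed contributes `y - P y = l y • e`, from which the scalar `l y` is pulled out; this is
why the degree drops by one. -/
theorem FormalMultilinearSeries.divSeries_apply {E : Type*} [NormedAddCommGroup E]
    [NormedSpace ℂ E] (p : FormalMultilinearSeries ℂ E ℂ) (P : E →L[ℂ] E) (e : E)
    (l : E →L[ℂ] ℂ) (hP : ∀ y, P y = y - l y • e) (n : ℕ) (y : E) :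
    l y * p.divSeries P e n (fun _ => y) =
      p (n + 1) (fun _ => y) - p (n + 1) (fun _ => P y) := by
  have h := (p (n + 1)).toMultilinearMap.map_piecewise_sub_map_piecewise (fun _ => y)
    (fun _ => P y) 0 Finset.univ
  simp only [Finset.piecewise_univ, Finset.mem_univ, if_true] at h
  simp only [ContinuousMultilinearMap.coe_coe] at h
  rw [h, divSeries, _root_.sum_apply, Finset.mul_sum]
  refine Finset.sum_congr rfl fun k _ => ?_
  rw [ContinuousMultilinearMap.compContinuousLinearMap_apply,
    ContinuousMultilinearMap.curryMid_apply, ← smul_eq_mul]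
  have hu := (p (n + 1)).map_update_smul
    (k.insertNth e fun i => (if k.succAbove i < k then ContinuousLinearMap.id ℂ E else P) y)
    k (l y) e
  have hs : Function.update (k.insertNth (α := fun _ => E) e fun i =>
      (if k.succAbove i < k then ContinuousLinearMap.id ℂ E else P) y) k e =
      k.insertNth e fun i => (if k.succAbove i < k then ContinuousLinearMap.id ℂ E else P) y := by
    rw [Function.update_eq_self_iff]
    simp
  rw [hs] at hu
  rw [← hu]
  refine congrArg (p (n + 1)) (funext fun j => ?_)
  rcases Fin.eq_self_or_eq_succAbove k j with rfl | ⟨i, rfl⟩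
  · simp [hP]
  · have hne : k.succAbove i ≠ k := Fin.succAbove_ne k i
    rw [Function.update_of_ne hne]
    simp only [Fin.insertNth_apply_succAbove, if_neg hne]
    split_ifs <;> rfl

/-- Each term is a sum of `n + 1 ≤ 2 ^ n` forms of norm at most `C / r ^ (n + 1) * ‖e‖ * K ^ n`,
where `K` bounds the norms of both the identity and `P`. Hence the radius is at least `r / (2 * K)`.
-/
theorem FormalMultilinearSeries.radius_divSeries_pos {E : Type*} [NormedAddCommGroup E]
    [NormedSpace ℂ E] (p : FormalMultilinearSeries ℂ E ℂ) (P : E →L[ℂ] E) (e : E)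
    (hp : 0 < p.radius) : 0 < (p.divSeries P e).radius := by
  obtain ⟨r, hr0, hr⟩ := ENNReal.lt_iff_exists_nnreal_btwn.1 hp
  have hr0' : 0 < r := by exact_mod_cast hr0
  obtain ⟨C, hC, hCp⟩ := p.norm_le_div_pow_of_pos_of_lt_radius hr0' hr
  set K : NNReal := 1 + ‖P‖₊ with hK
  have hK0 : 0 < K := by positivity
  have hKn : (K : ℝ) = 1 + ‖P‖ := by simp [hK]
  have hb : ∀ n, ‖p.divSeries P e n‖ ≤ (2 : ℝ) ^ n * ((C / (r : ℝ) ^ (n + 1)) * ‖e‖ * K ^ n) := by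
    intro n
    have hk : ∀ k : Fin (n + 1), ‖((p (n + 1)).curryMid k e).compContinuousLinearMap
        fun i => if k.succAbove i < k then ContinuousLinearMap.id ℂ E else P‖ ≤
        (C / (r : ℝ) ^ (n + 1)) * ‖e‖ * K ^ n := by
      intro k
      refine (ContinuousMultilinearMap.norm_compContinuousLinearMap_le _ _).trans ?_
      refine mul_le_mul ?_ ?_ (Finset.prod_nonneg fun _ _ => norm_nonneg _) (by positivity)
      · refine (((p (n + 1)).curryMid k).le_opNorm e).trans ?_
        rw [ContinuousMultilinearMap.norm_curryMid]
        exact mul_le_mul_of_nonneg_right (hCp _) (norm_nonneg _)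
      · calc _ ≤ ∏ i : Fin n, (K : ℝ) := by
              refine Finset.prod_le_prod (fun _ _ => norm_nonneg _) fun i _ => ?_
              split_ifs
              · refine ContinuousLinearMap.norm_id_le.trans ?_
                rw [hKn]; linarith [norm_nonneg P]
              · rw [hKn]; linarith
          _ = _ := by simp
    calc _ ≤ ∑ k : Fin (n + 1), (C / (r : ℝ) ^ (n + 1)) * ‖e‖ * K ^ n :=
          (norm_sum_le _ _).trans (Finset.sum_le_sum fun k _ => hk k)
      _ = ((n + 1 : ℕ) : ℝ) * ((C / (r : ℝ) ^ (n + 1)) * ‖e‖ * K ^ n) := by simp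
      _ ≤ _ := by
          refine mul_le_mul_of_nonneg_right ?_ (by positivity)
          exact_mod_cast (Nat.lt_two_pow_self (n := n))
  have h0 : 0 < r / (2 * K) := by positivity
  refine lt_of_lt_of_le (ENNReal.coe_pos.2 h0)
    ((p.divSeries P e).le_radius_of_bound (C / r * ‖e‖) fun n => ?_)
  refine (mul_le_mul_of_nonneg_right (hb n) (by positivity)).trans (le_of_eq ?_)
  have h1 : (r : ℝ) ≠ 0 := by exact_mod_cast hr0'.ne'
  have h2 : (K : ℝ) ≠ 0 := by exact_mod_cast hK0.ne'
  push_cast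
  rw [div_pow, mul_pow, pow_succ]
  field_simp

/-- Division of an analytic function by a linear form. -/
theorem AnalyticAt.exists_sub_eq_mul {E : Type*} [NormedAddCommGroup E] [NormedSpace ℂ E]
    {F : E → ℂ} {x : E} (hF : AnalyticAt ℂ F x) (l : E →L[ℂ] ℂ) (e : E) (hx : l x = 0) :
    ∃ G : E → ℂ, AnalyticAt ℂ G x ∧ ∀ᶠ y in 𝓝 x, F y - F (y - l y • e) = l y * G y := by
  obtain ⟨p, hp⟩ := hF
  set P : E →L[ℂ] E := ContinuousLinearMap.id ℂ E - l.smulRight e with hPdef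
  have hP : ∀ y, P y = y - l y • e := fun y => by simp [hPdef]
  set q := p.divSeries P e with hq
  have hqr : 0 < q.radius := p.radius_divSeries_pos P e hp.radius_pos
  have hqs := q.hasFPowerSeriesOnBall hqr
  refine ⟨fun y => q.sum (y - x), ?_, ?_⟩
  · have : AnalyticAt ℂ q.sum (x - x) := by
      rw [sub_self]
      exact hqs.analyticAt
    exact this.comp (f := fun y => y - x) (analyticAt_id.sub analyticAt_const)
  · have ht : Filter.Tendsto (fun y => y - x) (𝓝 x) (𝓝 0) := by
      have : Continuous fun y : E => y - x := by fun_prop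
      simpa using this.tendsto x
    have htP : Filter.Tendsto (fun y => P (y - x)) (𝓝 x) (𝓝 0) := by
      have : Continuous fun y : E => P (y - x) := by fun_prop
      simpa using this.tendsto x
    have hs := hp.eventually_hasSum
    filter_upwards [ht.eventually hs, htP.eventually hs,
      ht.eventually hqs.hasFPowerSeriesAt.eventually_hasSum] with y h1 h2 h3
    have hxy : x + P (y - x) = y - l y • e := by
      rw [hP, map_sub, hx, sub_zero]
      abel
    rw [add_sub_cancel] at h1
    rw [hxy] at h2
    rw [zero_add] at h3
    -- The constant terms of the two series agree, so the series of the difference starts in degree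
    -- one and matches the degree shift of `divSeries`.
    have h4 := (hasSum_nat_add_iff' 1).2 (h1.sub h2)
    have h0 : p 0 (fun _ => y - x) = p 0 (fun _ => P (y - x)) :=
      congrArg (p 0) (Subsingleton.elim _ _)
    simp only [Finset.range_one, Finset.sum_singleton, h0, sub_self, sub_zero] at h4
    have h5 := h3.mul_left (l y)
    refine h4.unique (h5.congr_fun fun n => ?_)
    rw [← p.divSeries_apply P e l hP, map_sub, hx, sub_zero]

/-- The algebra of entire functions on `ℂ^ι`. -/
def entire (ι : Type*) [Fintype ι] : Subalgebra ℂ ((ι → ℂ) → ℂ) where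
  carrier := {g | ∀ x, AnalyticAt ℂ g x}
  mul_mem' ha hb x := (ha x).mul (hb x)
  add_mem' ha hb x := (ha x).add (hb x)
  algebraMap_mem' _ _ := analyticAt_const

/-! ### Hyperplane restriction and monomial division for entire functions -/

namespace entire

theorem update_zero_eq {ι : Type*} [DecidableEq ι] (i : ι) :
    (fun y : ι → ℂ => Function.update y i 0) =
      (ContinuousLinearMap.id ℂ (ι → ℂ) -
        (ContinuousLinearMap.proj (R := ℂ) (φ := fun _ : ι => ℂ) i).smulRight
          (Pi.single i 1 : ι → ℂ) : (ι → ℂ) →L[ℂ] (ι → ℂ)) := by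
  funext y j
  by_cases h : j = i
  · subst h; simp
  · simp [h]

/-- The coordinate `z_i`. -/
def coord {ι : Type*} [Fintype ι] (i : ι) : entire ι :=
  ⟨fun y => y i, fun x => (ContinuousLinearMap.proj (R := ℂ) (φ := fun _ : ι => ℂ) i).analyticAt x⟩

/-- The locus `z_i ≠ 0` is dense and entire functions are continuous. This uniqueness of quotients
makes division additive and linear over the other coordinates. -/
theorem coord_mul_injective {ι : Type*} [Fintype ι] (i : ι) {a b : entire ι}
    (h : coord i * a = coord i * b) : a = b := by
  refine Subtype.ext (Continuous.ext_on (s := {y : ι → ℂ | y i ≠ 0}) ?_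
    (continuous_iff_continuousAt.2 fun x => (a.2 x).continuousAt)
    (continuous_iff_continuousAt.2 fun x => (b.2 x).continuousAt) ?_)
  · have : {y : ι → ℂ | y i ≠ 0} = (fun y : ι → ℂ => y i) ⁻¹' {0}ᶜ := rfl
    rw [this]
    exact (dense_compl_singleton (0 : ℂ)).preimage (isOpenMap_eval i)
  · intro y hy
    have := congrArg (fun f : entire ι => f.1 y) h
    exact mul_left_cancel₀ hy this

variable {ι : Type*} [Fintype ι] [DecidableEq ι]

theorem analyticAt_update_zero (i : ι) (x : ι → ℂ) :
    AnalyticAt ℂ (fun y : ι → ℂ => Function.update y i 0) x := by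
  rw [update_zero_eq]
  exact ContinuousLinearMap.analyticAt _ x

/-- Restriction to the hyperplane `z_i = 0`. -/
def restrict (i : ι) : entire ι →+* entire ι where
  toFun g := ⟨fun y => g.1 (Function.update y i 0),
    fun x => (g.2 _).comp (analyticAt_update_zero i x)⟩
  map_one' := rfl
  map_mul' _ _ := rfl
  map_zero' := rfl
  map_add' _ _ := rfl

/-- The quotient is given by an explicit global formula, the partial derivative on the hyperplane
and the difference quotient off it, so no gluing is needed. Near the hyperplane it coincides with
the analytic local quotient. -/
theorem exists_quotient (i : ι) (g : entire ι) :
    ∃ q : entire ι, g = restrict i g + coord i * q := by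
  classical
  have hupd : ∀ y : ι → ℂ, y - y i • Pi.single i (1 : ℂ) = Function.update y i 0 := by
    intro y
    rw [congrFun (update_zero_eq i) y]
    simp
  set Q : (ι → ℂ) → ℂ := fun y => if y i = 0 then fderiv ℂ g.1 y (Pi.single i 1)
    else (g.1 y - g.1 (Function.update y i 0)) / y i with hQ
  have hQa : ∀ x, AnalyticAt ℂ Q x := by
    intro x
    by_cases hx : x i = 0
    · obtain ⟨G, hG, hGe⟩ := (g.2 x).exists_sub_eq_mul
        (ContinuousLinearMap.proj (R := ℂ) (φ := fun _ : ι => ℂ) i) (Pi.single i 1) hx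
      refine hG.congr ?_
      filter_upwards [eventually_eventually_nhds.2 hGe, hG.eventually_analyticAt] with y hy hGy
      simp only [ContinuousLinearMap.proj_apply, hupd] at hy
      by_cases hyi : y i = 0
      · simp only [hQ, if_pos hyi]
        -- Differentiate this identity in the direction of `z_i` at a point of the hyperplane: the
        -- restricted function does not depend on `z_i`, and on the right only `G y` survives
        -- because `y i = 0`.
        have e1 : (fun z : ι → ℂ => g.1 z - g.1 (Function.update z i 0)) =ᶠ[𝓝 y]
          fun z => z i * G z := hy
        have hga : DifferentiableAt ℂ g.1 y := (g.2 y).differentiableAt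
        have hg0 : HasFDerivAt (fun z : ι → ℂ => g.1 (Function.update z i 0))
            ((fderiv ℂ g.1 (Function.update y i 0)).comp
              (fderiv ℂ (fun z : ι → ℂ => Function.update z i 0) y)) y :=
          (g.2 _).differentiableAt.hasFDerivAt.comp y
            (analyticAt_update_zero i y).differentiableAt.hasFDerivAt
        have hu : fderiv ℂ (fun z : ι → ℂ => Function.update z i 0) y (Pi.single i 1) = 0 := by
          rw [update_zero_eq, ContinuousLinearMap.fderiv]
          simp
        have e2 := e1.fderiv_eq (𝕜 := ℂ)
        have h1 : HasFDerivAt (fun z : ι → ℂ => z i)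
            (ContinuousLinearMap.proj (R := ℂ) (φ := fun _ : ι => ℂ) i) y :=
          (ContinuousLinearMap.proj (R := ℂ) (φ := fun _ : ι => ℂ) i).hasFDerivAt
        have e3 : fderiv ℂ (fun z : ι → ℂ => g.1 z - g.1 (Function.update z i 0)) y = _ :=
          (hga.hasFDerivAt.sub hg0).fderiv
        have e4 : fderiv ℂ (fun z : ι → ℂ => z i * G z) y = _ :=
          (h1.mul hGy.differentiableAt.hasFDerivAt).fderiv
        have e5 := congrArg (fun L : (ι → ℂ) →L[ℂ] ℂ => L (Pi.single i 1 : ι → ℂ))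
          (e3.symm.trans (e2.trans e4))
        simpa [hu, hyi] using e5.symm
      · simp only [hQ, if_neg hyi]
        rw [eq_div_iff hyi, hy.self_of_nhds, mul_comm]
    · have hne : ∀ᶠ y : ι → ℂ in 𝓝 x, y i ≠ 0 :=
        (continuous_apply i).continuousAt.eventually_ne hx
      have ha : AnalyticAt ℂ (fun y : ι → ℂ => (g.1 y - g.1 (Function.update y i 0)) / y i) x :=
        ((g.2 x).sub ((restrict i g).2 x)).div ((coord i).2 x) hx
      refine ha.congr ?_
      filter_upwards [hne] with y hy
      simp [hQ, hy]
  refine ⟨⟨Q, hQa⟩, Subtype.ext (funext fun y => ?_)⟩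
  change g.1 y = g.1 (Function.update y i 0) + y i * Q y
  by_cases hy : y i = 0
  · have : Function.update y i 0 = y := by rw [← hy, Function.update_eq_self]
    rw [this, hy, zero_mul, add_zero]
  · simp only [hQ, if_neg hy]
    field_simp
    ring

/-- The quotient `(g - g|_{z_i = 0}) / z_i`. -/
def quotient (i : ι) : entire ι →+ entire ι where
  toFun g := (exists_quotient i g).choose
  map_zero' := by
    apply coord_mul_injective i
    have := (exists_quotient i (0 : entire ι)).choose_spec
    rw [mul_zero]
    linear_combination -this - map_zero (restrict i)
  map_add' a b := by
    apply coord_mul_injective i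
    have h := (exists_quotient i (a + b)).choose_spec
    have ha := (exists_quotient i a).choose_spec
    have hb := (exists_quotient i b).choose_spec
    linear_combination -h + ha + hb - map_add (restrict i) a b

theorem restrict_add_coord_mul_quotient (i : ι) (g : entire ι) :
    restrict i g + coord i * quotient i g = g := (exists_quotient i g).choose_spec.symm

theorem restrict_coord_self (i : ι) : restrict i (coord i) = 0 :=
  Subtype.ext (funext fun y => by change Function.update y i 0 i = 0; simp)

theorem restrict_coord_of_ne {i j : ι} (h : j ≠ i) : restrict i (coord j) = coord j :=
  Subtype.ext (funext fun y => by change Function.update y i 0 j = y j; simp [h])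

theorem quotient_coord_mul (i : ι) (g : entire ι) : quotient i (coord i * g) = g := by
  apply coord_mul_injective i
  have := restrict_add_coord_mul_quotient i (coord i * g)
  rwa [map_mul, restrict_coord_self, zero_mul, zero_add] at this

theorem quotient_coord_mul_of_ne {i j : ι} (h : j ≠ i) (g : entire ι) :
    quotient i (coord j * g) = coord j * quotient i g := by
  apply coord_mul_injective i
  have h1 := restrict_add_coord_mul_quotient i (coord j * g)
  have h2 := restrict_add_coord_mul_quotient i g
  rw [map_mul, restrict_coord_of_ne h] at h1
  linear_combination h1 - coord j * h2

/-- Division by the monomial `∏_{i ∈ s} z_i` of functions that vanish on its zero set. -/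
theorem exists_addMonoidHom_prod_coord_mul (s : Finset ι) :
    ∃ Q : entire ι →+ entire ι, ∀ g, (∀ i ∈ s, restrict i g = 0) →
      (∏ i ∈ s, coord i) * Q g = g := by
  induction s using Finset.induction_on with
  | empty => exact ⟨AddMonoidHom.id _, fun g _ => by simp⟩
  | insert i s hi ih =>
    obtain ⟨Q, hQ⟩ := ih
    refine ⟨Q.comp (quotient i), fun g hg => ?_⟩
    have h1 : coord i * quotient i g = g := by
      have := restrict_add_coord_mul_quotient i g
      rwa [hg i (by simp), zero_add] at this
    -- Division by `z_i` preserves vanishing on `z_j = 0`: restriction to that hyperplane fixes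
    -- `z_i`, which can then be cancelled.
    have h2 : ∀ j ∈ s, restrict j (quotient i g) = 0 := by
      intro j hj
      have hij : i ≠ j := by
        rintro rfl
        exact hi hj
      apply coord_mul_injective i
      rw [mul_zero, ← restrict_coord_of_ne hij, ← map_mul, h1]
      exact hg j (by simp [hj])
    rw [Finset.prod_insert hi, mul_assoc, AddMonoidHom.comp_apply, hQ _ h2, h1]

theorem prod_coord_mul_injective (s : Finset ι) {a b : entire ι}
    (h : (∏ i ∈ s, coord i) * a = (∏ i ∈ s, coord i) * b) : a = b := by
  induction s using Finset.induction_on with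
  | empty => simpa using h
  | insert i s hi ih =>
    rw [Finset.prod_insert hi, mul_assoc, mul_assoc] at h
    exact ih (coord_mul_injective i h)

end entire

/-! ## Koszul complexes of alternating forms -/

namespace Koszul

variable {N B : Type*} [AddCommGroup N] [CommRing B] {ι : Type*} [Fintype ι]

/-- The Koszul differential `α ↦ ∑_i z_i ι_{ρ_i} α` on alternating forms. -/
def diff (z : ι → B) (ρ : ι → N) {k : ℕ} (α : N [⋀^Fin (k + 1)]→ₗ[ℤ] B) : N [⋀^Fin k]→ₗ[ℤ] B :=
  ∑ i, z i • α.curryLeft (ρ i)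

theorem diff_apply (z : ι → B) (ρ : ι → N) {k : ℕ} (α : N [⋀^Fin (k + 1)]→ₗ[ℤ] B)
    (v : Fin k → N) : diff z ρ α v = ∑ i, z i * α (Matrix.vecCons (ρ i) v) := by
  have h : ∀ s : Finset ι, (∑ i ∈ s, z i • α.curryLeft (ρ i)) v =
      ∑ i ∈ s, z i * α (Matrix.vecCons (ρ i) v) := by
    classical
    intro s
    induction s using Finset.induction_on with
    | empty => simp
    | insert i s hi ih =>
      rw [Finset.sum_insert hi, Finset.sum_insert hi, AlternatingMap.add_apply, ih]
      rfl
  exact h Finset.univ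

theorem diff_sub (z : ι → B) (ρ : ι → N) {k : ℕ} (α β : N [⋀^Fin (k + 1)]→ₗ[ℤ] B) :
    diff z ρ (α - β) = diff z ρ α - diff z ρ β := by
  ext v
  simp [diff_apply, mul_sub]

theorem diff_add (z : ι → B) (ρ : ι → N) {k : ℕ} (α β : N [⋀^Fin (k + 1)]→ₗ[ℤ] B) :
    diff z ρ (α + β) = diff z ρ α + diff z ρ β := by
  ext v
  simp [diff_apply, mul_add, Finset.sum_add_distrib]

theorem diff_smul (z : ι → B) (ρ : ι → N) {k : ℕ} (c : B) (α : N [⋀^Fin (k + 1)]→ₗ[ℤ] B) :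
    diff z ρ (c • α) = c • diff z ρ α := by
  ext v
  simp only [diff_apply, AlternatingMap.smul_apply, smul_eq_mul, Finset.mul_sum]
  exact Finset.sum_congr rfl fun i _ => by ring

theorem curryLeft_anticomm {k : ℕ} (α : N [⋀^Fin (k + 2)]→ₗ[ℤ] B) (x y : N) :
    (α.curryLeft x).curryLeft y = -(α.curryLeft y).curryLeft x := by
  have h0 := α.curryLeft_same (x + y)
  simp only [map_add, AlternatingMap.curryLeft_add, LinearMap.add_apply,
    AlternatingMap.curryLeft_same, zero_add, add_zero] at h0
  exact eq_neg_of_add_eq_zero_right h0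

/-- The terms for `(i, j)` and `(j, i)` cancel. The diagonal terms vanish by themselves, so 2 need
not be invertible in `B`. -/
theorem diff_diff (z : ι → B) (ρ : ι → N) {k : ℕ} (α : N [⋀^Fin (k + 2)]→ₗ[ℤ] B) :
    diff z ρ (diff z ρ α) = 0 := by
  classical
  ext v
  simp only [diff_apply, Finset.mul_sum, AlternatingMap.zero_apply]
  have hanti : ∀ i j, α (Matrix.vecCons (ρ j) (Matrix.vecCons (ρ i) v)) =
      -α (Matrix.vecCons (ρ i) (Matrix.vecCons (ρ j) v)) := fun i j =>
    congrArg (fun β => β v) (curryLeft_anticomm α (ρ j) (ρ i))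
  have hself : ∀ i, α (Matrix.vecCons (ρ i) (Matrix.vecCons (ρ i) v)) = 0 := fun i =>
    α.map_eq_zero_of_eq (i := 0) (j := 1) _ rfl (by simp)
  rw [← Finset.sum_product', Finset.univ_product_univ]
  refine Finset.sum_involution (fun p _ => (p.2, p.1)) ?_ ?_ ?_ ?_
  · rintro ⟨i, j⟩ -
    simp only [hanti i j]
    ring
  · rintro ⟨i, j⟩ - hne heq
    obtain rfl : j = i := (Prod.ext_iff.1 heq).1
    exact hne (by simp [hself])
  · simp
  · simp

/-- The exterior product of an integral linear form with an alternating form. -/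
def wedge (φ : N →ₗ[ℤ] ℤ) {k : ℕ} (α : N [⋀^Fin k]→ₗ[ℤ] B) : N [⋀^Fin (k + 1)]→ₗ[ℤ] B :=
  AlternatingMap.alternatizeUncurryFin (φ.smulRight α)

theorem wedge_apply (φ : N →ₗ[ℤ] ℤ) {k : ℕ} (α : N [⋀^Fin k]→ₗ[ℤ] B) (v : Fin (k + 1) → N) :
    wedge φ α v = ∑ i : Fin (k + 1), (-1) ^ (i : ℕ) * ((φ (v i) : B) * α (i.removeNth v)) := by
  rw [wedge, AlternatingMap.alternatizeUncurryFin_apply]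
  refine Finset.sum_congr rfl fun i _ => ?_
  simp [zsmul_eq_mul]

/-- Contraction is an antiderivation; this is the homotopy formula behind the exactness of the
Koszul complex. -/
theorem curryLeft_wedge (φ : N →ₗ[ℤ] ℤ) {k : ℕ} (α : N [⋀^Fin (k + 1)]→ₗ[ℤ] B) (x : N) :
    (wedge φ α).curryLeft x = φ x • α - wedge φ (α.curryLeft x) := by
  ext v
  rw [AlternatingMap.curryLeft_apply_apply, wedge_apply, Fin.sum_univ_succ,
    AlternatingMap.sub_apply, wedge_apply, sub_eq_add_neg, ← Finset.sum_neg_distrib]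
  congr 1
  · simp [zsmul_eq_mul]
  · refine Finset.sum_congr rfl fun i _ => ?_
    have : i.succ.removeNth (Matrix.vecCons x v) = Matrix.vecCons x (i.removeNth v) := by
      funext j
      refine Fin.cases ?_ (fun j => ?_) j <;> simp [Fin.removeNth]
    rw [this]
    simp [pow_succ]

theorem wedge_zero (φ : N →ₗ[ℤ] ℤ) {k : ℕ} : wedge φ (0 : N [⋀^Fin k]→ₗ[ℤ] B) = 0 := by
  ext v
  simp [wedge_apply]

/-- By the antiderivation rule the only other term is `φ ∧ ι_y ι_x α`, and either alternative forces
`ι_y ι_x α = 0`. -/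
theorem wedge_curryLeft_apply (φ : N →ₗ[ℤ] ℤ) {k : ℕ} (α : N [⋀^Fin (k + 1)]→ₗ[ℤ] B) (x y : N)
    (v : Fin k → N) (h : α.curryLeft y = 0 ∨ y = x) :
    wedge φ (α.curryLeft x) (Matrix.vecCons y v) = φ y • α (Matrix.vecCons x v) := by
  cases k with
  | zero =>
    rw [wedge_apply]
    simp only [AlternatingMap.curryLeft_apply_apply, Fin.sum_univ_succ, Fin.sum_univ_zero]
    rw [show Fin.removeNth 0 (Matrix.vecCons y v) = v from Subsingleton.elim _ _]
    simp
  | succ k =>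
    have h0 : (α.curryLeft x).curryLeft y = 0 := by
      rcases h with h | rfl
      · rw [curryLeft_anticomm, h]
        ext
        simp
      · exact α.curryLeft_same y
    have h1 := congrArg (fun f => f v) (curryLeft_wedge φ (α.curryLeft x) y)
    simp only [h0, wedge_zero, sub_zero] at h1
    exact h1

/-- The Koszul complex of a sequence `z_i` is exact in positive degrees if there are operators `Q_i`
of division by `z_i` that commute with multiplication by `z_j` for `j ≠ i`. -/
theorem exists_diff_eq [DecidableEq ι] (b : Module.Basis ι ℤ N) (z : ι → B) (Q : ι → B →+ B)
    (hself : ∀ i g, Q i (z i * g) = g) (hne : ∀ i j g, j ≠ i → Q i (z j * g) = z j * Q i g)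
    {k : ℕ} (α : N [⋀^Fin (k + 1)]→ₗ[ℤ] B) (hα : diff z b α = 0) :
    ∃ β : N [⋀^Fin (k + 2)]→ₗ[ℤ] B, diff z b β = α := by
  -- One basis direction is eliminated at a time. A form of positive degree whose contractions with
  -- all basis vectors vanish is zero.
  suffices H : ∀ s : Finset ι, ∃ β : N [⋀^Fin (k + 2)]→ₗ[ℤ] B,
      ∀ i ∈ s, (α - diff z b β).curryLeft (b i) = 0 by
    obtain ⟨β, hβ⟩ := H Finset.univ
    refine ⟨β, (sub_eq_zero.1 ?_).symm⟩
    have : (α - diff z b β).curryLeft = 0 := b.ext fun i => hβ i (Finset.mem_univ i)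
    ext v
    have h := congrArg (fun f => f (v 0) (Fin.tail v)) this
    simpa [Matrix.vecCons] using h
  intro s
  induction s using Finset.induction_on with
  | empty => exact ⟨0, by simp⟩
  | insert i s hi ih =>
    obtain ⟨β, hβ⟩ := ih
    set γ := α - diff z b β with hγ
    have hγd : diff z b γ = 0 := by rw [hγ, diff_sub, hα, diff_diff, sub_zero]
    set q : B →ₗ[ℤ] B := (Q i).toIntLinearMap with hq
    have hqa : ∀ x, q x = Q i x := fun _ => rfl
    have hcoord : ∀ j, j ≠ i → b.coord i (b j) = 0 := fun j hj => by
      simp [Module.Basis.coord_apply, hj]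
    have hcoordi : b.coord i (b i) = 1 := by simp [Module.Basis.coord_apply]
    -- Divide `b_i^* ∧ γ` by `z_i`. The identity `key` says that `γ - dη` arises by applying `1 -
    -- z_i Q_i` to `γ - b_i^* ∧ ι_{b_i} γ`, the part of `γ` that does not involve `b_i^*`.
    set η := q.compAlternatingMap (wedge (b.coord i) γ) with hη
    have key : ∀ v, γ v - diff z b η v = (γ v - z i * Q i (γ v)) -
        (wedge (b.coord i) (γ.curryLeft (b i)) v -
          z i * Q i (wedge (b.coord i) (γ.curryLeft (b i)) v)) := by
      intro v
      have hw : ∀ j, wedge (b.coord i) γ (Matrix.vecCons (b j) v) =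
          (b.coord i (b j) • γ - wedge (b.coord i) (γ.curryLeft (b j))) v := fun j =>
        congrArg (fun f => f v) (curryLeft_wedge (b.coord i) γ (b j))
      have h1 : diff z b η v = z i * Q i (γ v - wedge (b.coord i) (γ.curryLeft (b i)) v) -
          ∑ j ∈ Finset.univ.erase i, Q i (z j * wedge (b.coord i) (γ.curryLeft (b j)) v) := by
        rw [diff_apply, ← Finset.add_sum_erase _ _ (Finset.mem_univ i), sub_eq_add_neg,
          ← Finset.sum_neg_distrib]
        congr 1
        · rw [hη, LinearMap.compAlternatingMap_apply, hw, hcoordi, one_smul]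
          rfl
        · refine Finset.sum_congr rfl fun j hj => ?_
          have hji := Finset.ne_of_mem_erase hj
          rw [hη, LinearMap.compAlternatingMap_apply, hw, hcoord j hji, zero_smul, zero_sub,
            hne i j _ hji, AlternatingMap.neg_apply, map_neg, mul_neg, hqa]
      -- Closedness of `γ` enters here: the left side is zero, so applying `Q i` expresses the terms
      -- with `j ≠ i` through the term with `j = i`.
      have h2 : wedge (b.coord i) (diff z b γ) v =
          ∑ j, z j * wedge (b.coord i) (γ.curryLeft (b j)) v := by
        simp only [wedge_apply, diff_apply, Finset.mul_sum]
        rw [Finset.sum_comm]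
        refine Finset.sum_congr rfl fun j _ => Finset.sum_congr rfl fun l _ => ?_
        rw [AlternatingMap.curryLeft_apply_apply]
        ring
      rw [hγd, wedge_zero, AlternatingMap.zero_apply,
        ← Finset.add_sum_erase _ _ (Finset.mem_univ i)] at h2
      have h3 := congrArg (Q i) h2
      rw [map_zero, map_add, hself, map_sum] at h3
      rw [h1, map_sub]
      linear_combination -h3
    refine ⟨β + η, fun j hj => ?_⟩
    have e : α - diff z b (β + η) = γ - diff z b η := by rw [diff_add, hγ, sub_sub]
    rw [e]
    ext v
    rw [AlternatingMap.curryLeft_apply_apply, AlternatingMap.sub_apply, key]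
    -- For `j = i` both contractions agree; for `j ∈ s` both vanish, so directions already
    -- eliminated stay eliminated.
    have hwj : wedge (b.coord i) (γ.curryLeft (b i)) (Matrix.vecCons (b j) v) =
        γ (Matrix.vecCons (b j) v) := by
      rcases Finset.mem_insert.1 hj with rfl | hjs
      · rw [wedge_curryLeft_apply _ _ _ _ _ (Or.inr rfl), hcoordi, one_smul]
      · have hji : j ≠ i := by
          rintro rfl
          exact hi hjs
        rw [wedge_curryLeft_apply _ _ _ _ _ (Or.inl (hβ j hjs)), hcoord j hji, zero_smul]
        exact (congrArg (fun f => f v) (hβ j hjs)).symm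
    rw [hwj]
    simp
end Koszul

/-! ## Shellings of complete projective fans -/

theorem eventually_add_mul_neg {a : ℝ} (ha : a < 0) (b : ℝ) :
    ∀ᶠ ε : ℝ in 𝓝[>] 0, a + ε * b < 0 := by
  have hc : Continuous fun ε : ℝ => a + ε * b := by fun_prop
  have ht : Filter.Tendsto (fun ε : ℝ => a + ε * b) (𝓝[>] 0) (𝓝 a) := by
    have := hc.tendsto 0
    rw [zero_mul, add_zero] at this
    exact this.mono_left nhdsWithin_le_nhds
  exact ht.eventually_lt_const ha

namespace SmoothFan

variable {n d : ℕ} (S : SmoothFan n d)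

/-- The generator of the `i`-th ray as a vector of `ℝ^n`. -/
def realRay (i : Fin d) : Fin n → ℝ := fun j => S.ray i j

theorem mem_latticeCone {σ : Finset (Fin d)} {x : Fin n → ℝ} :
    x ∈ latticeCone S.ray σ ↔ ∃ c : Fin d → ℝ, (∀ i, 0 ≤ c i) ∧ (∀ i ∉ σ, c i = 0) ∧
      x = ∑ i ∈ σ, c i • S.realRay i := by
  refine exists_congr fun c => and_congr_right fun _ => and_congr_right fun hσ => ?_
  have : ∑ i ∈ σ, c i • S.realRay i = ∑ i, c i • S.realRay i :=
    Finset.sum_subset (Finset.subset_univ σ) fun i _ hi => by rw [hσ i hi, zero_smul]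
  rw [this, funext_iff]
  simp [realRay]

/-- An integral basis expresses the standard vectors of `ℝ^n`, hence spans; `n` spanning vectors
form a basis. -/
theorem exists_realBasis {σ : Finset (Fin d)} (hσ : σ ∈ S.cones) :
    ∃ (b : Module.Basis (Fin n) ℝ (Fin n → ℝ)) (e : σ ↪ Fin n),
      ∀ i : σ, b (e i) = S.realRay i := by
  obtain ⟨b, e, hb⟩ := S.smooth σ hσ
  have hspan : ⊤ ≤ Submodule.span ℝ (Set.range fun (j : Fin n) (l : Fin n) => ((b j l : ℤ) : ℝ)) := by
    rw [← (Pi.basisFun ℝ (Fin n)).span_eq, Submodule.span_le]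
    rintro _ ⟨l, rfl⟩
    have h := b.sum_repr (Pi.single l 1)
    have h2 : Pi.basisFun ℝ (Fin n) l = ∑ j, ((b.repr (Pi.single l 1) j : ℤ) : ℝ) •
        fun l : Fin n => ((b j l : ℤ) : ℝ) := by
      funext q
      have hq := congrArg (fun f : Fin n → ℤ => ((f q : ℤ) : ℝ)) h
      simp only [Finset.sum_apply, Pi.smul_apply, smul_eq_mul, Int.cast_sum, Int.cast_mul] at hq
      simp only [Finset.sum_apply, Pi.smul_apply, smul_eq_mul, hq, Pi.basisFun_apply,
        Pi.single_apply]
      split_ifs <;> simp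
    rw [SetLike.mem_coe, h2]
    exact Submodule.sum_mem _ fun j _ => Submodule.smul_mem _ _ (Submodule.subset_span ⟨j, rfl⟩)
  refine ⟨basisOfTopLeSpanOfCardEqFinrank _ hspan (by simp), e, fun i => ?_⟩
  rw [coe_basisOfTopLeSpanOfCardEqFinrank, hb i]
  rfl

theorem card_le {σ : Finset (Fin d)} (hσ : σ ∈ S.cones) : σ.card ≤ n := by
  obtain ⟨b, e, -⟩ := S.smooth σ hσ
  simpa using Fintype.card_le_of_embedding e

theorem linearIndepOn_realRay {σ : Finset (Fin d)} (hσ : σ ∈ S.cones) :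
    LinearIndepOn ℝ S.realRay (σ : Set (Fin d)) := by
  obtain ⟨b, e, hb⟩ := S.exists_realBasis hσ
  have h := b.linearIndependent.comp e e.injective
  have h2 : (b ∘ e) = fun i : σ => S.realRay i := funext hb
  rw [h2] at h
  exact h

/-- The sum of the generators is a relative interior point of the cone of `γ`. It lies in the common
face `γ ∩ σ`, and by linear independence all its coordinates there must be 1. -/
theorem subset_of_sum_realRay_mem {γ σ : Finset (Fin d)} (hγ : γ ∈ S.cones) (hσ : σ ∈ S.cones)
    (h : ∑ i ∈ γ, S.realRay i ∈ latticeCone S.ray σ) : γ ⊆ σ := by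
  classical
  have h1 : ∑ i ∈ γ, S.realRay i ∈ latticeCone S.ray γ := by
    refine S.mem_latticeCone.2 ⟨fun i => if i ∈ γ then 1 else 0, fun i => ?_, fun i hi => ?_, ?_⟩
    · dsimp only
      split_ifs <;> norm_num
    · simp [hi]
    · exact Finset.sum_congr rfl fun i hi => by simp [hi]
  have h2 : ∑ i ∈ γ, S.realRay i ∈ latticeCone S.ray (γ ∩ σ) := by
    rw [← S.inter γ hγ σ hσ]
    exact ⟨h1, h⟩
  obtain ⟨c, -, hc, hsum⟩ := S.mem_latticeCone.1 h2
  have h3 : ∑ i ∈ γ, (1 - c i) • S.realRay i = 0 := by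
    have : ∑ i ∈ γ ∩ σ, c i • S.realRay i = ∑ i ∈ γ, c i • S.realRay i :=
      Finset.sum_subset Finset.inter_subset_left fun i _ hi => by rw [hc i hi, zero_smul]
    simp only [sub_smul, one_smul, Finset.sum_sub_distrib]
    rw [← this, ← hsum, sub_self]
  intro i hi
  have h4 := (linearIndepOn_finset_iff.1 (S.linearIndepOn_realRay hγ)) _ h3 i hi
  by_contra hiσ
  rw [hc i (fun h => hiσ (Finset.mem_inter.1 h).2)] at h4
  norm_num at h4

/-- Coordinates with respect to the generators of a cone of maximal dimension. -/
theorem exists_coordinates {σ : Finset (Fin d)} (hσ : σ ∈ S.cones) (hn : σ.card = n) :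
    ∃ κ : Fin d → (Fin n → ℝ) →ₗ[ℝ] ℝ, (∀ x, x = ∑ i ∈ σ, κ i x • S.realRay i) ∧
      (∀ i ∈ σ, κ i (S.realRay i) = 1) ∧ (∀ i ∈ σ, ∀ j ∈ σ, j ≠ i → κ i (S.realRay j) = 0) ∧
      ∀ x, x ∈ latticeCone S.ray σ ↔ ∀ i ∈ σ, 0 ≤ κ i x := by
  classical
  obtain ⟨b, e, hb⟩ := S.exists_realBasis hσ
  have he : Function.Bijective e := (Fintype.bijective_iff_injective_and_card e).2
    ⟨e.injective, by simp [hn]⟩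
  set E := Equiv.ofBijective e he with hE
  set b' := b.reindex E.symm with hb'
  have hb'i : ∀ i : σ, b' i = S.realRay i := fun i => by simp [hb', hE, hb]
  set κ : Fin d → (Fin n → ℝ) →ₗ[ℝ] ℝ := fun i => if h : i ∈ σ then b'.coord ⟨i, h⟩ else 0 with hκ
  have hsum : ∀ x, x = ∑ i ∈ σ, κ i x • S.realRay i := by
    intro x
    conv_lhs => rw [← b'.sum_repr x]
    rw [← Finset.sum_coe_sort σ fun i => κ i x • S.realRay i]
    exact Finset.sum_congr rfl fun i _ => by simp [hκ, hb'i, Module.Basis.coord_apply]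
  have h1 : ∀ i ∈ σ, κ i (S.realRay i) = 1 := fun i hi => by
    have := hb'i ⟨i, hi⟩
    simp only at this
    simp [hκ, hi, ← this, Module.Basis.coord_apply]
  have h0 : ∀ i ∈ σ, ∀ j ∈ σ, j ≠ i → κ i (S.realRay j) = 0 := fun i hi j hj hij => by
    have := hb'i ⟨j, hj⟩
    simp only at this
    simp [hκ, hi, ← this, Module.Basis.coord_apply, hij]
  refine ⟨κ, hsum, h1, h0, fun x => ⟨fun hx i hi => ?_, fun hx => ?_⟩⟩
  · obtain ⟨c, hc0, hc, rfl⟩ := S.mem_latticeCone.1 hx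
    rw [map_sum, Finset.sum_eq_single i]
    · simpa [h1 i hi] using hc0 i
    · intro j hj hij
      simp [h0 i hi j hj hij]
    · exact fun h => (h hi).elim
  · refine S.mem_latticeCone.2 ⟨fun i => if i ∈ σ then κ i x else 0, fun i => ?_, fun i hi => ?_, ?_⟩
    · dsimp only
      split_ifs with h
      · exact hx i h
      · exact le_rfl
    · simp [hi]
    · conv_lhs => rw [hsum x]
      exact Finset.sum_congr rfl fun i hi => by simp [hi]

theorem latticeCone_subset_span (σ : Finset (Fin d)) {x : Fin n → ℝ}
    (hx : x ∈ latticeCone S.ray σ) : x ∈ Submodule.span ℝ (S.realRay '' (σ : Set (Fin d))) := by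
  obtain ⟨c, -, -, rfl⟩ := S.mem_latticeCone.1 hx
  exact Submodule.sum_mem _ fun i hi =>
    Submodule.smul_mem _ _ (Submodule.subset_span ⟨i, hi, rfl⟩)

/-- A vector is generic if it is not in the span of fewer than `n` rays. -/
def IsGeneric (v : Fin n → ℝ) : Prop :=
  ∀ γ : Finset (Fin d), γ.card < n → v ∉ Submodule.span ℝ (S.realRay '' (γ : Set (Fin d)))

/-- A real vector space is not a finite union of proper subspaces. -/
theorem exists_isGeneric : ∃ v, S.IsGeneric v := by
  classical
  by_contra! h
  have hU : ⋃ γ : {γ : Finset (Fin d) // γ.card < n},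
      ((Submodule.span ℝ (S.realRay '' (γ.1 : Set (Fin d))) : Submodule ℝ (Fin n → ℝ)) :
        Set (Fin n → ℝ)) = Set.univ := by
    refine Set.eq_univ_of_forall fun v => ?_
    have := h v
    simp only [IsGeneric, not_forall, not_not] at this
    obtain ⟨γ, hγ, hv⟩ := this
    exact Set.mem_iUnion.2 ⟨⟨γ, hγ⟩, hv⟩
  obtain ⟨γ, hγ⟩ := Subspace.exists_eq_top_of_iUnion_eq_univ hU
  have h1 := finrank_span_finset_le_card (R := ℝ) (γ.1.image S.realRay)
  rw [Finset.coe_image, Set.finrank, hγ, finrank_top] at h1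
  have h2 := h1.trans Finset.card_image_le
  have h3 := γ.2
  simp at h2
  omega

/-! ### Generic displacements and the shelling order -/

variable {S}

/-- A half-line in a generic direction meets each lower-dimensional cone at most once, since two
hits would put a multiple of `v` in its span. For small `ε` only cones of maximal dimension remain.
-/
theorem IsGeneric.eventually_mem_maximal {v : Fin n → ℝ} (hv : S.IsGeneric v)
    (hcomplete : S.IsComplete) (y : Fin n → ℝ) :
    ∀ᶠ ε : ℝ in 𝓝[>] 0, ∃ σ ∈ S.cones, σ.card = n ∧ y + ε • v ∈ latticeCone S.ray σ := by
  have h : ∀ γ : Finset (Fin d), ∀ᶠ ε : ℝ in 𝓝[>] 0, γ.card < n →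
      y + ε • v ∉ latticeCone S.ray γ := by
    intro γ
    by_cases hγ : γ.card < n
    swap
    · exact Filter.Eventually.of_forall fun ε h => (hγ h).elim
    by_cases hex : ∃ t : ℝ, 0 < t ∧ y + t • v ∈ latticeCone S.ray γ
    · obtain ⟨t, ht, hy⟩ := hex
      filter_upwards [Ioo_mem_nhdsGT ht] with ε hε _ hy2
      have h1 := Submodule.sub_mem _ (S.latticeCone_subset_span γ hy)
        (S.latticeCone_subset_span γ hy2)
      have h2 : y + t • v - (y + ε • v) = (t - ε) • v := by
        rw [sub_smul]; abel
      rw [h2] at h1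
      exact hv γ hγ ((Submodule.smul_mem_iff _ (sub_ne_zero.2 hε.2.ne')).1 h1)
    · filter_upwards [self_mem_nhdsWithin] with ε hε _ hy
      exact hex ⟨ε, hε, hy⟩
  filter_upwards [Filter.eventually_all.2 h] with ε hε
  obtain ⟨σ, hσ, hx⟩ := hcomplete (y + ε • v)
  refine ⟨σ, hσ, ?_, hx⟩
  by_contra hne
  exact hε σ (lt_of_le_of_ne (S.card_le hσ) hne) hx

/-- In a complete fan every cone is a face of a cone of maximal dimension. -/
theorem IsComplete.exists_maximal (hcomplete : S.IsComplete) {γ : Finset (Fin d)}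
    (hγ : γ ∈ S.cones) : ∃ σ ∈ S.cones, σ.card = n ∧ γ ⊆ σ := by
  obtain ⟨v, hv⟩ := S.exists_isGeneric
  set y := ∑ i ∈ γ, S.realRay i with hy
  suffices H : ∃ σ ∈ S.cones, σ.card = n ∧ y ∈ latticeCone S.ray σ by
    obtain ⟨σ, hσ, hn, h⟩ := H
    exact ⟨σ, hσ, hn, S.subset_of_sum_realRay_mem hγ hσ h⟩
  by_contra! hne
  -- Maximal cones are closed: if `y` violates one of the inequalities, so does `y + ε • v` for
  -- small `ε`.
  have h : ∀ σ : Finset (Fin d), ∀ᶠ ε : ℝ in 𝓝[>] 0, σ ∈ S.cones → σ.card = n →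
      y + ε • v ∉ latticeCone S.ray σ := by
    intro σ
    by_cases hσ : σ ∈ S.cones ∧ σ.card = n
    swap
    · exact Filter.Eventually.of_forall fun ε h1 h2 => (hσ ⟨h1, h2⟩).elim
    obtain ⟨κ, -, -, -, hκ⟩ := S.exists_coordinates hσ.1 hσ.2
    have h1 := hne σ hσ.1 hσ.2
    rw [hκ] at h1
    push Not at h1
    obtain ⟨i, hi, hneg⟩ := h1
    filter_upwards [eventually_add_mul_neg hneg (κ i v)] with ε hε _ _ hmem
    have h2 := (hκ _).1 hmem i hi
    rw [map_add, map_smul, smul_eq_mul] at h2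
    linarith
  obtain ⟨ε, h1, σ, hσ, hn, hmem⟩ :=
    ((Filter.eventually_all.2 h).and (hv.eventually_mem_maximal hcomplete y)).exists
  exact h1 σ hσ hn hmem

theorem IsProjective.exists_linear (hprojective : S.IsProjective) :
    ∃ (ψ : (Fin n → ℝ) → ℝ) (M : Finset (Fin d) → (Fin n → ℝ) →ₗ[ℝ] ℝ),
      ∀ σ ∈ S.cones, σ.card = n → (∀ x ∈ latticeCone S.ray σ, M σ x = ψ x) ∧
        ∀ x ∉ latticeCone S.ray σ, M σ x < ψ x := by
  obtain ⟨ψ, hψ⟩ := hprojective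
  have : ∀ σ : Finset (Fin d), ∃ M : (Fin n → ℝ) →ₗ[ℝ] ℝ, σ ∈ S.cones → σ.card = n →
      (∀ x ∈ latticeCone S.ray σ, M x = ψ x) ∧ ∀ x ∉ latticeCone S.ray σ, M x < ψ x := by
    intro σ
    by_cases hσ : σ ∈ S.cones ∧ σ.card = n
    · obtain ⟨m, h1, h2⟩ := hψ σ hσ.1 hσ.2
      refine ⟨∑ j, (m j : ℝ) • LinearMap.proj j, fun _ _ => ⟨fun x hx => ?_, fun x hx => ?_⟩⟩
      · rw [h1 x hx]
        simp
      · have := h2 x hx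
        simpa using this
    · exact ⟨0, fun h1 h2 => (hσ ⟨h1, h2⟩).elim⟩
  choose M hM using this
  exact ⟨ψ, M, hM⟩

/-- A complete projective fan is shellable: if the maximal cones `σ` are ordered by decreasing
`w σ`, then `τ σ` is the minimal face of `σ` that is not a face of an earlier cone. -/
theorem exists_shelling (hcomplete : S.IsComplete) (hprojective : S.IsProjective) :
    ∃ (w : Finset (Fin d) → ℝ) (τ : Finset (Fin d) → Finset (Fin d)),
      ∀ σ ∈ S.cones, σ.card = n → τ σ ⊆ σ ∧
        (∀ i ∈ τ σ, ∃ σ' ∈ S.cones, σ'.card = n ∧ σ.erase i ⊆ σ' ∧ w σ < w σ') ∧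
        ∀ σ' ∈ S.cones, σ'.card = n → σ' ≠ σ → τ σ ⊆ σ' → w σ' < w σ := by
  classical
  obtain ⟨ψ, M, hM⟩ := hprojective.exists_linear
  obtain ⟨v, hv⟩ := S.exists_isGeneric
  have hκ : ∀ σ : Finset (Fin d), ∃ κ : Fin d → (Fin n → ℝ) →ₗ[ℝ] ℝ,
      σ ∈ S.cones → σ.card = n → (∀ x, x = ∑ i ∈ σ, κ i x • S.realRay i) ∧
      (∀ i ∈ σ, κ i (S.realRay i) = 1) ∧ (∀ i ∈ σ, ∀ j ∈ σ, j ≠ i → κ i (S.realRay j) = 0) ∧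
      ∀ x, x ∈ latticeCone S.ray σ ↔ ∀ i ∈ σ, 0 ≤ κ i x := by
    intro σ
    by_cases hσ : σ ∈ S.cones ∧ σ.card = n
    · obtain ⟨κ, h⟩ := S.exists_coordinates hσ.1 hσ.2
      exact ⟨κ, fun _ _ => h⟩
    · exact ⟨0, fun h1 h2 => (hσ ⟨h1, h2⟩).elim⟩
  choose κ hκ using hκ
  -- The weight is the linear piece of `ψ` on `σ`, evaluated at `v`. The set `τ σ` consists of the
  -- rays whose opposite facet separates `σ` from `v`.
  refine ⟨fun σ => M σ v, fun σ => σ.filter fun i => κ σ i v < 0, fun σ hσ hn => ?_⟩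
  obtain ⟨hsum, h1, h0, hmem⟩ := hκ σ hσ hn
  have hray : ∀ γ ⊆ σ, ∑ i ∈ γ, S.realRay i ∈ latticeCone S.ray σ := by
    intro γ hγ
    rw [hmem]
    intro i hi
    rw [map_sum]
    refine Finset.sum_nonneg fun j hj => ?_
    by_cases hij : j = i
    · rw [hij, h1 i hi]
      exact zero_le_one
    · rw [h0 i hi j (hγ hj) hij]
  refine ⟨Finset.filter_subset _ _, fun i hi => ?_, fun σ' hσ' hn' hne hτ => ?_⟩
  · rw [Finset.mem_filter] at hi
    obtain ⟨hi, hneg⟩ := hi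
    by_contra! hno
    have hface := S.face_mem σ hσ _ (Finset.erase_subset i σ)
    -- Move from an interior point `y` of the facet towards `v`. This leaves `σ`, so there the form
    -- `M σ` is strictly below `ψ`.
    set y := ∑ j ∈ σ.erase i, S.realRay j with hy
    have hyσ : y ∈ latticeCone S.ray σ := hray _ (Finset.erase_subset i σ)
    have hyi : κ σ i y = 0 := by
      rw [hy, map_sum]
      exact Finset.sum_eq_zero fun j hj =>
        h0 i hi j (Finset.mem_of_mem_erase hj) (Finset.ne_of_mem_erase hj)
    -- If no cone through the facet had larger weight, `M σ` would dominate all pieces near `y`: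
    -- cones that contain `y` contain the facet, and for the others `M σ' y < ψ y = M σ y`.
    have h : ∀ σ' : Finset (Fin d), ∀ᶠ ε : ℝ in 𝓝[>] 0, σ' ∈ S.cones → σ'.card = n →
        M σ' (y + ε • v) ≤ M σ (y + ε • v) := by
      intro σ'
      by_cases hc : σ' ∈ S.cones ∧ σ'.card = n
      swap
      · exact Filter.Eventually.of_forall fun ε h1 h2 => (hc ⟨h1, h2⟩).elim
      obtain ⟨hσ', hn'⟩ := hc
      by_cases hyσ' : y ∈ latticeCone S.ray σ'
      · have h3 := hno σ' hσ' hn' (S.subset_of_sum_realRay_mem hface hσ' hyσ')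
        filter_upwards [self_mem_nhdsWithin] with ε hε _ _
        rw [map_add, map_add, map_smul, map_smul, (hM σ' hσ' hn').1 y hyσ', (hM σ hσ hn).1 y hyσ]
        have : ε • M σ' v ≤ ε • M σ v := mul_le_mul_of_nonneg_left h3 (le_of_lt hε)
        linarith
      · have h3 := (hM σ' hσ' hn').2 y hyσ'
        rw [← (hM σ hσ hn).1 y hyσ] at h3
        filter_upwards [eventually_add_mul_neg (sub_neg.2 h3) (M σ' v - M σ v)] with ε hε _ _
        rw [map_add, map_add, map_smul, map_smul, smul_eq_mul, smul_eq_mul]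
        linarith
    obtain ⟨ε, ⟨hε1, σ', hσ', hn', hε2⟩, hε⟩ := (((Filter.eventually_all.2 h).and
      (hv.eventually_mem_maximal hcomplete y)).and self_mem_nhdsWithin).exists
    have hnot : y + ε • v ∉ latticeCone S.ray σ := by
      intro hin
      have := (hmem _).1 hin i hi
      rw [map_add, map_smul, hyi, zero_add, smul_eq_mul] at this
      exact absurd this (not_le.2 (mul_neg_of_pos_of_neg hε hneg))
    have h3 := (hM σ hσ hn).2 _ hnot
    have h4 := (hM σ' hσ' hn').1 _ hε2
    have h5 := hε1 σ' hσ' hn'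
    linarith
  · have hle : ∀ j ∈ σ, M σ' (S.realRay j) ≤ M σ (S.realRay j) := by
      intro j hj
      have hjσ : S.realRay j ∈ latticeCone S.ray σ := by
        simpa using hray {j} (by simpa using hj)
      rw [(hM σ hσ hn).1 _ hjσ]
      by_cases hjσ' : S.realRay j ∈ latticeCone S.ray σ'
      · exact ((hM σ' hσ' hn').1 _ hjσ').le
      · exact ((hM σ' hσ' hn').2 _ hjσ').le
    have hlt : ∀ j ∈ σ, j ∉ σ' → M σ' (S.realRay j) < M σ (S.realRay j) := by
      intro j hj hj'
      have hjσ : S.realRay j ∈ latticeCone S.ray σ := by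
        simpa using hray {j} (by simpa using hj)
      rw [(hM σ hσ hn).1 _ hjσ]
      refine (hM σ' hσ' hn').2 _ fun hin => hj' ?_
      have := S.subset_of_sum_realRay_mem (S.ray_mem j) hσ' (by simpa using hin)
      simpa using this
    -- Expand `v` in the rays of `σ`. At these rays `M σ' ≤ ψ = M σ`, with equality where the
    -- coefficient is negative, since those rays lie in `σ'`. Some ray of `σ` is not in `σ'`; there
    -- the inequality is strict, and genericity makes its coefficient positive rather than zero.
    have hnz : ∀ j ∈ σ, κ σ j v ≠ 0 := by
      intro j hj hz
      have hcard : (σ.erase j).card < n := by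
        rw [← hn]
        exact Finset.card_erase_lt_of_mem hj
      refine hv _ hcard ?_
      rw [hsum v, ← Finset.add_sum_erase _ _ hj, hz, zero_smul, zero_add]
      exact Submodule.sum_mem _ fun i hi =>
        Submodule.smul_mem _ _ (Submodule.subset_span ⟨i, hi, rfl⟩)
    have hv1 : M σ v = ∑ j ∈ σ, κ σ j v * M σ (S.realRay j) := by
      conv_lhs => rw [hsum v]
      simp
    have hv2 : M σ' v = ∑ j ∈ σ, κ σ j v * M σ' (S.realRay j) := by
      conv_lhs => rw [hsum v]
      simp
    have hex : ∃ j ∈ σ, j ∉ σ' := by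
      by_contra! hsub
      exact hne (Finset.eq_of_subset_of_card_le hsub (by rw [hn, hn'])).symm
    have heq : ∀ j ∈ σ, κ σ j v < 0 → M σ' (S.realRay j) = M σ (S.realRay j) := by
      intro j hj hneg
      have hj' : j ∈ σ' := hτ (Finset.mem_filter.2 ⟨hj, hneg⟩)
      have hjσ : S.realRay j ∈ latticeCone S.ray σ := by
        simpa using hray {j} (by simpa using hj)
      have hjσ' : S.realRay j ∈ latticeCone S.ray σ' := by
        refine S.mem_latticeCone.2 ⟨Pi.single j 1, fun i => ?_, fun i hi => ?_, ?_⟩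
        · by_cases h : i = j
          · subst h; simp
          · simp [h]
        · have : i ≠ j := by
            rintro rfl
            exact hi hj'
          simp [this]
        · rw [Finset.sum_eq_single j]
          · simp
          · intro i _ hij
            simp [hij]
          · exact fun h => (h hj').elim
      rw [(hM σ hσ hn).1 _ hjσ, (hM σ' hσ' hn').1 _ hjσ']
    change M σ' v < M σ v
    rw [hv1, hv2]
    refine Finset.sum_lt_sum (fun j hj => ?_) ?_
    · rcases lt_or_ge (κ σ j v) 0 with h | h
      · rw [heq j hj h]
      · exact mul_le_mul_of_nonneg_left (hle j hj) h
    · obtain ⟨j, hj, hj'⟩ := hex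
      refine ⟨j, hj, mul_lt_mul_of_pos_left (hlt j hj hj') ?_⟩
      refine lt_of_le_of_ne (not_lt.1 fun h => hj' ?_) (hnz j hj).symm
      exact hτ (Finset.mem_filter.2 ⟨hj, h⟩)

end SmoothFan

/-! ## Exactness of the bracket -/

namespace SmoothFan

variable {n d : ℕ} (S : SmoothFan n d)

theorem mem_space_of_support {σ : Finset (Fin d)} (hσ : σ ∈ S.cones) {z : Fin d → ℂ}
    (hz : ∀ i ∉ σ, z i = 0) : z ∈ S.space := by
  intro P hP
  by_contra hne
  refine hP.1 (S.face_mem σ hσ P fun i hi => ?_)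
  by_contra hiσ
  exact hne (Finset.prod_eq_zero hi (hz i hiσ))

/-- The support of `z` is a cone: otherwise it contains a minimal non-cone, which is a primitive
collection whose monomial does not vanish at `z`. With `mem_space_of_support` this makes `X` the
union of the spaces `ℂ^σ`. -/
theorem exists_cone_of_mem_space {z : Fin d → ℂ} (hz : z ∈ S.space) :
    ∃ σ ∈ S.cones, ∀ i ∉ σ, z i = 0 := by
  classical
  refine ⟨Finset.univ.filter fun i => z i ≠ 0, ?_, fun i hi => by simpa using hi⟩
  by_contra hno
  obtain ⟨P, hPle, hP⟩ := exists_minimal_le_of_wellFoundedLT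
    (fun Q : Finset (Fin d) => Q ∉ S.cones) _ hno
  have hprim : S.IsPrimitiveCollection P :=
    ⟨hP.prop, fun Q hQ => not_not.1 fun h => hP.not_lt h hQ⟩
  obtain ⟨i, hi, h0⟩ := Finset.prod_eq_zero_iff.1 (hz P hprim)
  exact (Finset.mem_filter.1 (hPle hi)).2 h0

theorem euler_coord (i l : Fin d) : S.euler i (S.coord l) = if l = i then S.coord i else 0 := by
  refine Subtype.ext (funext fun x => ?_)
  have hF : S.IsLocalExtension (S.coord l : S.space → ℂ) x (fun y => y l) :=
    ⟨(ContinuousLinearMap.proj (R := ℂ) (φ := fun _ : Fin d => ℂ) l).analyticAt _,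
      Filter.Eventually.of_forall fun _ _ => rfl⟩
  have h1 : fderiv ℂ (fun y : Fin d → ℂ => y l) (x : Fin d → ℂ) =
      ContinuousLinearMap.proj (R := ℂ) (φ := fun _ : Fin d => ℂ) l :=
    (ContinuousLinearMap.proj (R := ℂ) (φ := fun _ : Fin d => ℂ) l).hasFDerivAt.fderiv
  rw [S.euler_apply, S.eulerFun_eq i hF, h1]
  by_cases h : l = i
  · subst h
    simp [coord]
  · simp [h]

theorem euler_superpotential (i : Fin d) : S.euler i S.superpotential = S.coord i := by
  rw [superpotential, map_sum, Finset.sum_eq_single i]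
  · simp [euler_coord]
  · intro l _ hl
    simp [euler_coord, hl]
  · simp

/-- Because `θ_i f = z_i`, expanding each `ρ_i` in the standard basis regroups the sum over the
frame into a sum over the rays. -/
theorem bracket_superpotential (k : ℕ) (α : S.PolyVector (k + 1)) :
    S.bracket S.superpotential k α = Koszul.diff S.coord S.ray α := by
  ext1 v
  have hray : ∀ i, S.ray i = ∑ j, S.ray i j • (Pi.single j 1 : Fin n → ℤ) := fun i => by
    conv_lhs => rw [← (Pi.basisFun ℤ (Fin n)).sum_repr (S.ray i)]
    simp
  have hcurry : ∀ i, α (Matrix.vecCons (S.ray i) v) = ∑ j, S.ray i j • contract j α v := by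
    intro i
    change α.curryLeft (S.ray i) v = _
    conv_lhs => rw [hray i, map_sum, sum_polyVector_apply]
    refine Finset.sum_congr rfl fun j _ => ?_
    rw [map_smul]
    rfl
  rw [bracket_apply, Koszul.diff_apply]
  simp only [hcurry, Finset.mul_sum, frame_apply, euler_superpotential, Finset.sum_mul]
  rw [Finset.sum_comm]
  refine Finset.sum_congr rfl fun i _ => Finset.sum_congr rfl fun j _ => ?_
  rw [smul_mul_assoc, mul_smul_comm]

/-! ### Restriction to the coordinate space of a cone and pullback from it -/

variable {S}

/-- The inclusion of the coordinate space `ℂ^σ` into `ℂ^d`. -/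
def coordInclusion (σ : Finset (Fin d)) : (σ → ℂ) →L[ℂ] (Fin d → ℂ) :=
  ContinuousLinearMap.pi fun i =>
    if h : i ∈ σ then ContinuousLinearMap.proj (R := ℂ) (φ := fun _ : σ => ℂ) ⟨i, h⟩ else 0

theorem coordInclusion_apply_mem {σ : Finset (Fin d)} (y : σ → ℂ) {i : Fin d} (h : i ∈ σ) :
    coordInclusion σ y i = y ⟨i, h⟩ := by
  simp [coordInclusion, h]

theorem coordInclusion_apply_notMem {σ : Finset (Fin d)} (y : σ → ℂ) {i : Fin d} (h : i ∉ σ) :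
    coordInclusion σ y i = 0 := by
  simp [coordInclusion, h]

/-- The projection of `ℂ^d` onto the coordinate space `ℂ^σ`. -/
def coordProjection (σ : Finset (Fin d)) : (Fin d → ℂ) →L[ℂ] (σ → ℂ) :=
  ContinuousLinearMap.pi fun i => ContinuousLinearMap.proj (R := ℂ) (φ := fun _ : Fin d => ℂ) i

theorem coordProjection_apply (σ : Finset (Fin d)) (z : Fin d → ℂ) (i : σ) :
    coordProjection σ z i = z i := rfl

theorem coordProjection_coordInclusion (σ : Finset (Fin d)) (y : σ → ℂ) :
    coordProjection σ (coordInclusion σ y) = y :=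
  funext fun i => coordInclusion_apply_mem y i.2

theorem coordInclusion_mem_space {σ : Finset (Fin d)} (hσ : σ ∈ S.cones) (y : σ → ℂ) :
    coordInclusion σ y ∈ S.space :=
  S.mem_space_of_support hσ fun _ hi => coordInclusion_apply_notMem y hi

/-- Restriction of holomorphic functions on `X` to the coordinate space of a cone. -/
def restrictCone {σ : Finset (Fin d)} (hσ : σ ∈ S.cones) : S.hol →+* entire σ where
  toFun h := ⟨fun y => h.1 ⟨coordInclusion σ y, coordInclusion_mem_space hσ y⟩, fun y => by
    obtain ⟨F, hF, hFe⟩ := h.2 ⟨coordInclusion σ y, coordInclusion_mem_space hσ y⟩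
    have ha : AnalyticAt ℂ (fun y => F (coordInclusion σ y)) y :=
      AnalyticAt.comp (g := F) hF ((coordInclusion σ).analyticAt y)
    refine ha.congr ?_
    filter_upwards [(coordInclusion σ).continuous.continuousAt.eventually hFe] with y' hy'
    exact (hy' (coordInclusion_mem_space hσ y')).symm⟩
  map_one' := rfl
  map_mul' _ _ := rfl
  map_zero' := rfl
  map_add' _ _ := rfl

theorem restrictCone_apply {σ : Finset (Fin d)} (hσ : σ ∈ S.cones) (h : S.hol) (y : σ → ℂ) :
    (restrictCone hσ h).1 y = h.1 ⟨coordInclusion σ y, coordInclusion_mem_space hσ y⟩ := rfl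

variable (S) in
/-- Pullback of entire functions on a coordinate space to `X` along the projection. -/
def pullback (σ : Finset (Fin d)) : entire σ →+* S.hol where
  toFun g := ⟨fun x => g.1 (coordProjection σ x), fun _ =>
    ⟨fun z => g.1 (coordProjection σ z), (g.2 _).comp ((coordProjection σ).analyticAt _),
      Filter.Eventually.of_forall fun _ _ => rfl⟩⟩
  map_one' := rfl
  map_mul' _ _ := rfl
  map_zero' := rfl
  map_add' _ _ := rfl

theorem restrictCone_pullback {σ : Finset (Fin d)} (hσ : σ ∈ S.cones) (g : entire σ) :
    restrictCone hσ (S.pullback σ g) = g := by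
  refine Subtype.ext (funext fun y => ?_)
  change g.1 (coordProjection σ (coordInclusion σ y)) = g.1 y
  rw [coordProjection_coordInclusion]

theorem restrictCone_coord_mem {σ : Finset (Fin d)} (hσ : σ ∈ S.cones) (i : σ) :
    restrictCone hσ (S.coord i) = entire.coord i :=
  Subtype.ext (funext fun y => coordInclusion_apply_mem y i.2)

theorem restrictCone_coord_notMem {σ : Finset (Fin d)} (hσ : σ ∈ S.cones) {i : Fin d}
    (hi : i ∉ σ) : restrictCone hσ (S.coord i) = 0 :=
  Subtype.ext (funext fun y => coordInclusion_apply_notMem y hi)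

/-- A function that vanishes on `ℂ^{σ'}`, where `σ'` contains all rays of `σ` but `i`, vanishes on
the hyperplane `z_i = 0` of `ℂ^σ`. -/
theorem restrict_restrictCone_eq_zero {σ σ' : Finset (Fin d)} (hσ : σ ∈ S.cones)
    (hσ' : σ' ∈ S.cones) (i : σ) (hsub : σ.erase i ⊆ σ') {h : S.hol}
    (hh : restrictCone hσ' h = 0) : entire.restrict i (restrictCone hσ h) = 0 := by
  refine Subtype.ext (funext fun y => ?_)
  set x := coordInclusion σ (Function.update y i 0) with hx
  have hmem : x ∈ S.space := coordInclusion_mem_space hσ _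
  have hx0 : ∀ j ∉ σ', x j = 0 := by
    intro j hj
    by_cases hjσ : j ∈ σ
    · rw [hx, coordInclusion_apply_mem _ hjσ]
      have : j = i := by
        by_contra hne
        exact hj (hsub (Finset.mem_erase.2 ⟨hne, hjσ⟩))
      have : (⟨j, hjσ⟩ : σ) = i := Subtype.ext this
      rw [this, Function.update_self]
    · exact coordInclusion_apply_notMem _ hjσ
  have hx' : coordInclusion σ' (coordProjection σ' x) = x := by
    funext j
    by_cases hj : j ∈ σ'
    · rw [coordInclusion_apply_mem _ hj, coordProjection_apply]
    · rw [coordInclusion_apply_notMem _ hj, hx0 j hj]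
  have h1 := congrArg (fun g : entire σ' => g.1 (coordProjection σ' x)) hh
  simp only [restrictCone_apply] at h1
  change h.1 ⟨x, hmem⟩ = 0
  have hxx : (⟨coordInclusion σ' (coordProjection σ' x), coordInclusion_mem_space hσ' _⟩ : S.space) =
      ⟨x, hmem⟩ := Subtype.ext hx'
  rw [← hxx]
  exact h1

/-- The basis of `N` given by the rays of a cone of maximal dimension. -/
theorem exists_basis {σ : Finset (Fin d)} (hσ : σ ∈ S.cones) (hn : σ.card = n) :
    ∃ b : Module.Basis σ ℤ (Fin n → ℤ), ∀ i, b i = S.ray i := by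
  obtain ⟨b, e, hb⟩ := S.smooth σ hσ
  have he : Function.Bijective e := (Fintype.bijective_iff_injective_and_card e).2
    ⟨e.injective, by simp [hn]⟩
  exact ⟨b.reindex (Equiv.ofBijective e he).symm, fun i => by simp [hb]⟩

/-- The effect of an additive map on the coefficients of alternating forms. -/
def mapCoeff {N A B : Type*} [AddCommGroup N] [CommRing A] [CommRing B] (r : A →+ B) {k : ℕ}
    (α : N [⋀^Fin k]→ₗ[ℤ] A) : N [⋀^Fin k]→ₗ[ℤ] B :=
  r.toIntLinearMap.compAlternatingMap α

theorem mapCoeff_apply {N A B : Type*} [AddCommGroup N] [CommRing A] [CommRing B] (r : A →+ B)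
    {k : ℕ} (α : N [⋀^Fin k]→ₗ[ℤ] A) (v : Fin k → N) : mapCoeff r α v = r (α v) := rfl

theorem mapCoeff_restrictCone_diff {σ : Finset (Fin d)} (hσ : σ ∈ S.cones) {k : ℕ}
    (α : S.PolyVector (k + 1)) :
    mapCoeff (restrictCone hσ : S.hol →+ entire σ) (Koszul.diff S.coord S.ray α) =
      Koszul.diff entire.coord (fun i : σ => S.ray i)
        (mapCoeff (restrictCone hσ : S.hol →+ entire σ) α) := by
  ext1 v
  rw [mapCoeff_apply, Koszul.diff_apply, Koszul.diff_apply]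
  simp only [mapCoeff_apply, AddMonoidHom.coe_coe, map_sum, map_mul]
  rw [← Finset.sum_subset (Finset.subset_univ σ), ← Finset.sum_coe_sort σ]
  · exact Finset.sum_congr rfl fun i _ => by rw [restrictCone_coord_mem]
  · intro i _ hi
    rw [restrictCone_coord_notMem hσ hi, zero_mul]

/-- The step of the induction along a shelling: a cycle that vanishes on the coordinate spaces of
the cones in `U` can be modified by a boundary so that it also vanishes on `ℂ^σ`. -/
theorem exists_restrictCone_sub_diff_eq_zero {σ τ : Finset (Fin d)} (hσ : σ ∈ S.cones)
    (hn : σ.card = n) (hτ : τ ⊆ σ) (U : Set (Finset (Fin d))) (hU : U ⊆ S.cones)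
    (hfacet : ∀ i ∈ τ, ∃ σ' ∈ U, σ.erase i ⊆ σ') (hnew : ∀ σ' ∈ U, ¬ τ ⊆ σ')
    {k : ℕ} (α : S.PolyVector (k + 1)) (hα : Koszul.diff S.coord S.ray α = 0)
    (hαU : ∀ σ' (h : σ' ∈ U), mapCoeff (restrictCone (hU h) : S.hol →+ entire σ') α = 0) :
    ∃ γ : S.PolyVector (k + 2),
      mapCoeff (restrictCone hσ : S.hol →+ entire σ) (α - Koszul.diff S.coord S.ray γ) = 0 ∧
      ∀ σ' (h : σ' ∈ U), mapCoeff (restrictCone (hU h) : S.hol →+ entire σ')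
        (α - Koszul.diff S.coord S.ray γ) = 0 := by
  classical
  obtain ⟨b, hb⟩ := exists_basis hσ hn
  have hb' : (fun i : σ => S.ray i) = b := funext fun i => (hb i).symm
  set t : Finset σ := Finset.univ.filter fun i => (i : Fin d) ∈ τ with ht
  set m : entire σ := ∏ i ∈ t, entire.coord i with hm
  obtain ⟨Q, hQ⟩ := entire.exists_addMonoidHom_prod_coord_mul t
  set α' := mapCoeff (restrictCone hσ : S.hol →+ entire σ) α with hα'
  -- By `hfacet`, `α'` vanishes on the hyperplanes `z_i = 0` with `i ∈ τ`, so it is divisible by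
  -- `m`. Additivity of the division is what makes `β` an alternating form.
  set β := mapCoeff Q α' with hβ
  have hβα : m • β = α' := by
    ext1 v
    refine hQ _ fun i hi => ?_
    obtain ⟨σ', hσ', hsub⟩ := hfacet i (Finset.mem_filter.1 hi).2
    exact restrict_restrictCone_eq_zero hσ (hU hσ') i hsub
      (congrArg (fun f => f v) (hαU σ' hσ'))
  have hβ0 : Koszul.diff entire.coord b β = 0 := by
    ext1 v
    apply entire.prod_coord_mul_injective t
    have h1 : Koszul.diff entire.coord b (m • β) = 0 := by
      rw [hβα, ← hb', hα', ← mapCoeff_restrictCone_diff, hα]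
      ext1 v
      exact map_zero (restrictCone hσ)
    rw [Koszul.diff_smul] at h1
    have h2 := congrArg (fun f => f v) h1
    rw [AlternatingMap.zero_apply, mul_zero]
    exact h2
  obtain ⟨γ', hγ'⟩ := Koszul.exists_diff_eq b entire.coord entire.quotient
    entire.quotient_coord_mul (fun i j g h => entire.quotient_coord_mul_of_ne h g) β hβ0
  -- Keeping the factor `m` makes the pullback vanish on every `ℂ^{σ'}` with `σ' ∈ U`: some `i ∈ τ`
  -- is not a ray of `σ'`, so `z_i` is zero there.
  set γ : S.PolyVector (k + 2) := mapCoeff (S.pullback σ : entire σ →+ S.hol) (m • γ') with hγ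
  have hγσ : mapCoeff (restrictCone hσ : S.hol →+ entire σ) γ = m • γ' := by
    ext1 v
    exact restrictCone_pullback hσ _
  have hsub : ∀ {σ' : Finset (Fin d)} (h : σ' ∈ S.cones),
      mapCoeff (restrictCone h : S.hol →+ entire σ') (α - Koszul.diff S.coord S.ray γ) =
      mapCoeff (restrictCone h : S.hol →+ entire σ') α - Koszul.diff entire.coord
        (fun i : σ' => S.ray i) (mapCoeff (restrictCone h : S.hol →+ entire σ') γ) := by
    intro σ' h
    rw [← mapCoeff_restrictCone_diff]
    ext1 v
    exact map_sub (restrictCone h) _ _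
  refine ⟨γ, ?_, fun σ' hσ' => ?_⟩
  · rw [hsub, hγσ, hb', Koszul.diff_smul, hγ', hβα, sub_self]
  · have h0 : mapCoeff (restrictCone (hU hσ') : S.hol →+ entire σ') γ = 0 := by
      ext1 v
      change restrictCone (hU hσ') (S.pullback σ (m * γ' v)) = 0
      obtain ⟨i, hi, hi'⟩ := Finset.not_subset.1 (hnew σ' hσ')
      have hit : (⟨i, hτ hi⟩ : σ) ∈ t := by simp [ht, hi]
      have hc : S.pullback σ (entire.coord ⟨i, hτ hi⟩) = S.coord i := rfl
      rw [map_mul, map_mul, hm, map_prod, map_prod, Finset.prod_eq_zero hit, zero_mul]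
      rw [hc, restrictCone_coord_notMem _ hi']
    rw [hsub, hαU σ' hσ', h0]
    ext1 v
    simp [Koszul.diff_apply]

/-- The complex `(Θ^•, {f, -})` is exact in positive degrees. -/
theorem exists_bracket_eq (hcomplete : S.IsComplete) (hprojective : S.IsProjective) {k : ℕ}
    (α : S.PolyVector (k + 1)) (hα : S.bracket S.superpotential k α = 0) :
    ∃ β : S.PolyVector (k + 2), S.bracket S.superpotential (k + 1) β = α := by
  classical
  simp only [bracket_superpotential] at hα ⊢
  obtain ⟨w, τ, hshell⟩ := exists_shelling hcomplete hprojective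
  -- The induction runs over initial segments `U` of the shelling, the sets closed under larger
  -- weight. A cone of minimal weight can be removed, even when there are ties, because closure is
  -- only required for strict inequality.
  have H : ∀ (N : ℕ) (U : Finset (Finset (Fin d))), U.card = N →
      (∀ σ ∈ U, σ ∈ S.cones ∧ σ.card = n) →
      (∀ σ ∈ U, ∀ σ' ∈ S.cones, σ'.card = n → w σ < w σ' → σ' ∈ U) →
      ∃ γ : S.PolyVector (k + 2), ∀ σ ∈ U, ∀ hσ : σ ∈ S.cones,
        mapCoeff (restrictCone hσ : S.hol →+ entire σ) (α - Koszul.diff S.coord S.ray γ) = 0 := by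
    intro N
    induction N with
    | zero =>
      intro U hU _ _
      rw [Finset.card_eq_zero] at hU
      subst hU
      exact ⟨0, by simp⟩
    | succ N ih =>
      intro U hcard hmax hup
      have hne : U.Nonempty := by
        rw [← Finset.card_pos]
        omega
      obtain ⟨σ, hσU, hmin⟩ := Finset.exists_min_image U w hne
      obtain ⟨hσ, hn⟩ := hmax σ hσU
      obtain ⟨hτ, hfacet, hnew⟩ := hshell σ hσ hn
      obtain ⟨γ, hγ⟩ := ih (U.erase σ) (by rw [Finset.card_erase_of_mem hσU, hcard]; rfl)
        (fun σ' h => hmax σ' (Finset.mem_of_mem_erase h))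
        (fun σ₁ h₁ σ₂ h₂ hn₂ hw => by
          have h₁' := Finset.mem_of_mem_erase h₁
          refine Finset.mem_erase.2 ⟨?_, hup σ₁ h₁' σ₂ h₂ hn₂ hw⟩
          rintro rfl
          exact absurd (hmin σ₁ h₁') (not_le.2 hw))
      have hU : (↑(U.erase σ) : Set (Finset (Fin d))) ⊆ S.cones := fun σ' h =>
        (hmax σ' (Finset.mem_of_mem_erase h)).1
      obtain ⟨η, h1, h2⟩ := exists_restrictCone_sub_diff_eq_zero hσ hn hτ _ hU
        (fun i hi => by
          obtain ⟨σ', hσ', hn', hsub, hw⟩ := hfacet i hi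
          refine ⟨σ', Finset.mem_coe.2 (Finset.mem_erase.2 ⟨?_, hup σ hσU σ' hσ' hn' hw⟩), hsub⟩
          rintro rfl
          exact lt_irrefl _ hw)
        (fun σ' h hsub => by
          have h' := Finset.mem_erase.1 (Finset.mem_coe.1 h)
          obtain ⟨hσ', hn'⟩ := hmax σ' h'.2
          exact absurd (hmin σ' h'.2) (not_le.2 (hnew σ' hσ' hn' h'.1 hsub)))
        (α - Koszul.diff S.coord S.ray γ)
        (by rw [Koszul.diff_sub, hα, Koszul.diff_diff, sub_zero])
        (fun σ' h => hγ σ' h (hU h))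
      refine ⟨γ + η, fun σ' hσ' hc => ?_⟩
      rw [Koszul.diff_add, ← sub_sub]
      by_cases hs : σ' = σ
      · subst hs
        exact h1
      · exact h2 σ' (Finset.mem_coe.2 (Finset.mem_erase.2 ⟨hs, hσ'⟩))
  obtain ⟨γ, hγ⟩ := H _ (Finset.univ.filter fun σ => σ ∈ S.cones ∧ σ.card = n) rfl
    (fun σ hσ => (Finset.mem_filter.1 hσ).2)
    (fun σ _ σ' h1 h2 _ => Finset.mem_filter.2 ⟨Finset.mem_univ _, h1, h2⟩)
  refine ⟨γ, (sub_eq_zero.1 ?_).symm⟩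
  ext1 v
  refine Subtype.ext (funext fun x => ?_)
  -- Vanishing on the spaces of all maximal cones is vanishing on `X`, since every cone of a
  -- complete fan is a face of a maximal one.
  obtain ⟨ρ, hρ, hx⟩ := S.exists_cone_of_mem_space x.2
  obtain ⟨σ, hσ, hn, hsub⟩ := hcomplete.exists_maximal hρ
  have h1 := congrArg (fun f => (f v).1 (coordProjection σ x))
    (hγ σ (Finset.mem_filter.2 ⟨Finset.mem_univ _, hσ, hn⟩) hσ)
  have hx' : coordInclusion σ (coordProjection σ x) = x := by
    funext j
    by_cases hj : j ∈ σ
    · rw [coordInclusion_apply_mem _ hj, coordProjection_apply]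
    · rw [coordInclusion_apply_notMem _ hj, hx j fun h => hj (hsub h)]
  have hxx : (⟨coordInclusion σ (coordProjection σ x), coordInclusion_mem_space hσ _⟩ : S.space) =
      x := Subtype.ext hx'
  have h2 : ((α - Koszul.diff S.coord S.ray γ) v).1
      ⟨coordInclusion σ (coordProjection σ x), coordInclusion_mem_space hσ _⟩ = 0 := h1
  rw [hxx] at h2
  exact h2

end SmoothFan

/-! ## Formal consequences of exactness -/

namespace FormalSeries

variable {R A : Type*} [CommRing R] [AddCommGroup A] [Module R A]

theorem X_smul_zero (x : FormalSeries A) : ((X : R⟦X⟧) • x) 0 = 0 := by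
  rw [smul_coeff]
  simp

theorem X_smul_succ (x : FormalSeries A) (m : ℕ) : ((X : R⟦X⟧) • x) (m + 1) = x m := by
  rw [smul_coeff, Finset.sum_eq_single (1, m)]
  · simp
  · rintro ⟨i, j⟩ hij hne
    have : i ≠ 1 := by
      rintro rfl
      apply hne
      simp only [Finset.HasAntidiagonal.mem_antidiagonal] at hij
      rw [Prod.mk.injEq]
      omega
    simp [coeff_X, this]
  · intro h
    simp [add_comm] at h

/-- The series `(x - x_0) / u`. -/
def shift (x : FormalSeries A) : FormalSeries A := fun m => x (m + 1)

variable (R) in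
theorem X_smul_shift {x : FormalSeries A} (hx : x 0 = 0) : (X : R⟦X⟧) • shift x = x := by
  funext m
  cases m with
  | zero => rw [X_smul_zero, hx]
  | succ m => rw [X_smul_succ]; rfl

theorem X_smul_injective {x y : FormalSeries A} (h : (X : R⟦X⟧) • x = (X : R⟦X⟧) • y) : x = y := by
  funext m
  rw [← X_smul_succ (R := R) x, h, X_smul_succ]

theorem X_pow_smul_injective (p : ℕ) {x y : FormalSeries A}
    (h : (X : R⟦X⟧) ^ p • x = (X : R⟦X⟧) ^ p • y) : x = y := by
  induction p with
  | zero => simpa using h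
  | succ p ih =>
    rw [pow_succ', mul_smul, mul_smul] at h
    exact ih (X_smul_injective h)

/-- The constant series. -/
def const (a : A) : FormalSeries A := fun m => if m = 0 then a else 0

theorem const_zero (a : A) : const a 0 = a := rfl

end FormalSeries

theorem FilteredComplex.degeneratesAt_of_d_mem {R : Type} [CommRing R] {K : FilteredComplex R}
    {r₀ : ℤ} (h : ∀ r : ℤ, r₀ ≤ r → ∀ (p : ℤ) (i j : ℕ), ∀ x ∈ K.Z r p i,
      (K.C.d i j).hom x ∈ K.B r (p + r) j) : K.DegeneratesAt r₀ := by
  intro r hr p i j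
  refine Submodule.linearMap_qext _ (LinearMap.ext fun x => ?_)
  exact (Submodule.Quotient.mk_eq_zero _).2 (h r hr p i j x.1 x.2)

/-- To see that `d x` vanishes in `E_r`, it suffices to replace `x` by an element of the next step
of the filtration. -/
theorem FilteredComplex.d_mem_B_of_eq {R : Type} [CommRing R] {K : FilteredComplex R} {r p : ℤ}
    {j : ℕ} {x x' : K.C.X (j + 1)} (hx : x ∈ K.Z r p (j + 1)) (hx' : x' ∈ K.F (p + 1) (j + 1))
    (hd : (K.C.d (j + 1) j).hom x' = (K.C.d (j + 1) j).hom x) :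
    (K.C.d (j + 1) j).hom x ∈ K.B r (p + r) j := by
  -- With target index `p + r`, the boundary part of `B` is `d Z_{r-1}^{p+1}`, and `x'` lies in
  -- `Z_{r-1}^{p+1}` because its differential is that of `x`.
  refine Submodule.mem_sup_right (Submodule.mem_iSup_of_mem (j + 1) ⟨x', ⟨?_, ?_⟩, hd⟩)
  · rw [show p + r - r + 1 = p + 1 by ring]
    exact hx'
  · refine (Submodule.mem_iInf _).2 fun l => ?_
    rw [Submodule.mem_comap, show p + r - r + 1 + (r - 1) = p + r by ring]
    by_cases hl : j = l
    · subst hl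
      rw [hd]
      exact (Submodule.mem_iInf _).1 hx.2 j
    · have h0 : K.C.d (j + 1) l = 0 :=
        HomologicalComplex.shape _ _ _ fun h => hl (by simpa using h.symm)
      rw [h0]
      exact zero_mem _

/-- The projection of the degree zero part of a chain complex to its homology. -/
def ChainComplex.projHomologyZero {R : Type} [CommRing R] (C : ChainComplex (ModuleCat.{0} R) ℕ) :
    C.X 0 ⟶ C.homology 0 :=
  C.pOpcycles 0 ≫ C.isoHomologyι₀.inv

/-! ### Homology of chain complexes of modules in terms of elements -/

namespace ChainComplex

variable {R : Type} [CommRing R] (C : ChainComplex (ModuleCat.{0} R) ℕ)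

theorem iCycles_projHomologyZero : C.iCycles 0 ≫ C.projHomologyZero = C.homologyπ 0 := by
  rw [projHomologyZero, ← Category.assoc, ← HomologicalComplex.homology_π_ι, Category.assoc]
  simp

theorem projHomologyZero_iCycles (c : C.cycles 0) :
    C.projHomologyZero.hom ((C.iCycles 0).hom c) = (C.homologyπ 0).hom c :=
  congrArg (fun φ => φ.hom c) C.iCycles_projHomologyZero

theorem projHomologyZero_surjective : Function.Surjective C.projHomologyZero.hom := by
  have : Epi C.projHomologyZero := by
    unfold projHomologyZero
    infer_instance
  exact (ModuleCat.epi_iff_surjective _).1 this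

theorem projHomologyZero_eq_zero_iff (x : C.X 0) :
    C.projHomologyZero.hom x = 0 ↔ ∃ y : C.X 1, (C.d 1 0).hom y = x := by
  have h1 : C.projHomologyZero.hom x = 0 ↔ (C.pOpcycles 0).hom x = 0 := by
    constructor
    · intro h
      have h2 := congrArg C.isoHomologyι₀.hom.hom h
      rw [map_zero] at h2
      have h3 : C.projHomologyZero ≫ C.isoHomologyι₀.hom = C.pOpcycles 0 := by
        simp [projHomologyZero]
      rw [← h3]
      exact h2
    · intro h
      change C.isoHomologyι₀.inv.hom ((C.pOpcycles 0).hom x) = 0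
      rw [h, map_zero]
  have h2 : ∀ j, (ComplexShape.down ℕ).prev 0 = j →
      ((C.pOpcycles 0).hom x = 0 ↔ ∃ y : C.X j, (C.d j 0).hom y = x) := by
    rintro j rfl
    exact (C.sc 0).moduleCat_pOpcycles_eq_zero_iff x
  rw [h1, h2 1 (by simp)]

theorem subsingleton_homology_succ (k : ℕ) (h : ∀ x : C.X (k + 1), (C.d (k + 1) k).hom x = 0 →
    ∃ y : C.X (k + 2), (C.d (k + 2) (k + 1)).hom y = x) : Subsingleton (C.homology (k + 1)) := by
  have hex : C.ExactAt (k + 1) := by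
    rw [C.exactAt_iff' (k + 2) (k + 1) k (by simp) (by simp), ShortComplex.moduleCat_exact_iff]
    exact h
  exact ModuleCat.subsingleton_of_isZero hex.isZero_homology

end ChainComplex

/-! ### Degeneration and the homology of the twisted complex -/

namespace SmoothFan

variable {n d : ℕ} (S : SmoothFan n d)

theorem thetaComplex_d (k : ℕ) (α : S.PolyVector (k + 1)) :
    (S.thetaComplex.d (k + 1) k).hom α = S.bracket S.superpotential k α := by
  exact congrArg (fun φ => φ.hom α) (ChainComplex.of_d
    (fun k => ModuleCat.of ℂ (S.PolyVector k))
    (fun k => ModuleCat.ofHom (S.bracket S.superpotential k)) k)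

theorem twistedComplex_d (k : ℕ) (x : FormalSeries (S.PolyVector (k + 1))) :
    (S.twistedComplex.d (k + 1) k).hom x = S.twistedD k x := by
  exact congrArg (fun φ => φ.hom x) (ChainComplex.of_d
    (fun k => ModuleCat.of ℂ⟦X⟧ (FormalSeries (S.PolyVector k)))
    (fun k => ModuleCat.ofHom (S.twistedD k)) k)

theorem twistedD_zero (k : ℕ) (x : FormalSeries (S.PolyVector (k + 1))) :
    S.twistedD k x 0 = S.bracket S.superpotential k (x 0) := by
  rw [twistedD, LinearMap.add_apply, LinearMap.smul_apply, FormalSeries.add_coeff,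
    FormalSeries.X_smul_zero, add_zero]
  rfl

theorem twistedD_succ (k : ℕ) (x : FormalSeries (S.PolyVector (k + 1))) (m : ℕ) :
    S.twistedD k x (m + 1) = S.bracket S.superpotential k (x (m + 1)) + S.bv k (x m) := by
  rw [twistedD, LinearMap.add_apply, LinearMap.smul_apply, FormalSeries.add_coeff,
    FormalSeries.X_smul_succ]
  rfl

/-- Exactness of `(Θ^•, {f, -})` in positive degrees. -/
def IsBracketExact : Prop :=
  ∀ (k : ℕ) (α : S.PolyVector (k + 1)), S.bracket S.superpotential k α = 0 →
    ∃ β : S.PolyVector (k + 2), S.bracket S.superpotential (k + 1) β = α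

variable {S}

theorem bracket_bv_eq_neg (k : ℕ) (α : S.PolyVector (k + 2)) :
    S.bracket S.superpotential k (S.bv (k + 1) α) =
      -S.bv k (S.bracket S.superpotential (k + 1) α) :=
  eq_neg_of_add_eq_zero_left (S.bracket_bv _ k α)

/-- A series with closed constant term is congruent to a multiple of `u` modulo boundaries. -/
theorem IsBracketExact.exists_sub_twistedD_eq_smul (hS : S.IsBracketExact) {k : ℕ}
    (y : FormalSeries (S.PolyVector (k + 1))) (hy : S.twistedD k y 0 = 0) :
    ∃ (w : FormalSeries (S.PolyVector (k + 2))) (y' : FormalSeries (S.PolyVector (k + 1))),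
      y - S.twistedD (k + 1) w = (X : ℂ⟦X⟧) • y' := by
  -- Only the constant term matters: subtract the differential of the constant series on a primitive
  -- of `y 0`.
  rw [twistedD_zero] at hy
  obtain ⟨β, hβ⟩ := hS k (y 0) hy
  refine ⟨FormalSeries.const β, FormalSeries.shift (y - S.twistedD (k + 1) (FormalSeries.const β)),
    (FormalSeries.X_smul_shift ℂ ?_).symm⟩
  change y 0 - S.twistedD (k + 1) (FormalSeries.const β) 0 = 0
  rw [twistedD_zero, FormalSeries.const_zero, hβ, sub_self]

/-- Solve `{f, y_0} = x_0` and `{f, y_{m+1}} = x_{m+1} - ∂ y_m` recursively. -/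
theorem IsBracketExact.exists_twistedD_eq (hS : S.IsBracketExact) {k : ℕ}
    (x : FormalSeries (S.PolyVector (k + 1))) (hx : S.twistedD k x = 0) :
    ∃ y, S.twistedD (k + 1) y = x := by
  -- The choice of primitives is made total, with value 0 off the cycles, so that the recursion can
  -- be written down before its right-hand sides are known to be cycles.
  have hs : ∀ α : S.PolyVector (k + 1), ∃ β : S.PolyVector (k + 2),
      S.bracket S.superpotential k α = 0 → S.bracket S.superpotential (k + 1) β = α := by
    intro α
    by_cases h : S.bracket S.superpotential k α = 0
    · obtain ⟨β, hβ⟩ := hS k α h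
      exact ⟨β, fun _ => hβ⟩
    · exact ⟨0, fun h' => (h h').elim⟩
  choose s hs using hs
  let y : FormalSeries (S.PolyVector (k + 2)) :=
    fun m => Nat.rec (s (x 0)) (fun m ym => s (x (m + 1) - S.bv (k + 1) ym)) m
  have hx0 : S.bracket S.superpotential k (x 0) = 0 := by
    rw [← twistedD_zero, hx]
    rfl
  have hxs : ∀ m, S.bracket S.superpotential k (x (m + 1)) = -S.bv k (x m) := by
    intro m
    refine eq_neg_of_add_eq_zero_left ?_
    rw [← twistedD_succ, hx]
    rfl
  have hy0 : S.bracket S.superpotential (k + 1) (y 0) = x 0 := hs _ hx0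
  -- By anticommutation this bracket equals `∂({f, y_m} - x_m)`. It vanishes because `{f, y_m} -
  -- x_m` is 0 for `m = 0` and `-∂ y_{m-1}` otherwise, and `∂² = 0`.
  have hcyc : ∀ m, S.bracket S.superpotential k (x (m + 1) - S.bv (k + 1) (y m)) = 0 := by
    intro m
    rw [map_sub, hxs, bracket_bv_eq_neg]
    induction m with
    | zero => rw [hy0, sub_self]
    | succ m ih =>
      have hym : S.bracket S.superpotential (k + 1) (y (m + 1)) =
          x (m + 1) - S.bv (k + 1) (y m) := by
        refine hs _ ?_
        rw [map_sub, hxs, bracket_bv_eq_neg, ih]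
      rw [hym, map_sub, S.bv_bv, sub_zero, sub_self]
  refine ⟨y, funext fun m => ?_⟩
  cases m with
  | zero => rw [twistedD_zero, hy0]
  | succ m => rw [twistedD_succ, show S.bracket S.superpotential (k + 1) (y (m + 1)) =
      x (m + 1) - S.bv (k + 1) (y m) from hs _ (hcyc m), sub_add_cancel]

theorem IsBracketExact.degeneratesAt (hS : S.IsBracketExact) :
    (uAdicFiltration S.twistedComplex).DegeneratesAt 1 := by
  refine FilteredComplex.degeneratesAt_of_d_mem fun r hr p i j x hx => ?_
  by_cases hij : j + 1 = i
  swap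
  · have h0 : (uAdicFiltration S.twistedComplex).C.d i j = 0 :=
      HomologicalComplex.shape _ i j hij
    rw [h0]
    exact zero_mem _
  subst hij
  have key := fun x' => FilteredComplex.d_mem_B_of_eq (K := uAdicFiltration S.twistedComplex)
    (x' := x') hx
  rcases lt_or_ge p 0 with hp | hp
  -- For `p < 0` the filtration is constant from `p` to `p + 1`, so `x` itself serves.
  · refine key x ?_ rfl
    have hF : (uAdicFiltration S.twistedComplex).F (p + 1) (j + 1) =
        (uAdicFiltration S.twistedComplex).F p (j + 1) := by
      have h1 : (p + 1).toNat = 0 := by omega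
      have h2 : p.toNat = 0 := by omega
      simp only [uAdicFiltration, h1, h2]
      rfl
    rw [hF]
    exact hx.1
  · obtain ⟨y, hy⟩ := hx.1
    have hdx := (Submodule.mem_iInf _).1 hx.2 j
    obtain ⟨w, hw⟩ := hdx
    -- Here `r ≥ 1` is essential: with `x = u^p y`, the differential of `y` is divisible by `u`, so
    -- its constant term vanishes.
    obtain ⟨q, hq⟩ : ∃ q : ℕ, (p + r).toNat = p.toNat + (q + 1) :=
      ⟨(p + r).toNat - p.toNat - 1, by omega⟩
    change FormalSeries (S.PolyVector (j + 1)) at y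
    change FormalSeries (S.PolyVector j) at w
    have hy' : (X : ℂ⟦X⟧) ^ p.toNat • y = (show FormalSeries (S.PolyVector (j + 1)) from x) := hy
    have hw' : (X : ℂ⟦X⟧) ^ (p + r).toNat • w =
        S.twistedD j (show FormalSeries (S.PolyVector (j + 1)) from x) :=
      hw.trans (S.twistedComplex_d j x)
    rw [← hy', map_smul, hq, pow_add, mul_smul] at hw'
    have hD := FormalSeries.X_pow_smul_injective _ hw'
    have hD0 : S.twistedD j y 0 = 0 := by
      rw [← hD, pow_succ', mul_smul, FormalSeries.X_smul_zero]
    obtain ⟨v, y', hv⟩ := hS.exists_sub_twistedD_eq_smul y hD0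
    -- This element is `x` minus the differential of `u^p v`, hence has the same differential as
    -- `x`.
    refine key ((X : ℂ⟦X⟧) ^ (p + 1).toNat • y') ⟨y', rfl⟩ ?_
    have hp1 : (p + 1).toNat = p.toNat + 1 := by omega
    refine (S.twistedComplex_d j _).trans (Eq.trans ?_ (S.twistedComplex_d j x).symm)
    rw [hp1, pow_succ, mul_smul, ← hv, map_smul, map_sub, S.twistedD_twistedD, sub_zero]
    rw [← map_smul]
    exact congrArg _ hy'

theorem IsBracketExact.exists_homology_zero_equiv (hS : S.IsBracketExact) :
    ∃ e : S.twistedComplex.homology 0 ≃ₗ[PowerSeries ℂ] FormalSeries (S.thetaComplex.homology 0),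
      ∀ (c : S.twistedComplex.cycles 0) (c₀ : S.thetaComplex.cycles 0),
        (S.thetaComplex.iCycles 0).hom c₀ =
            S.constantTerm 0 ((S.twistedComplex.iCycles 0).hom c) →
          e ((S.twistedComplex.homologyπ 0).hom c) 0 = (S.thetaComplex.homologyπ 0).hom c₀ := by
  let q : S.PolyVector 0 →ₗ[ℂ] S.thetaComplex.homology 0 := S.thetaComplex.projHomologyZero.hom
  let π : FormalSeries (S.PolyVector 0) →ₗ[ℂ⟦X⟧] S.twistedComplex.homology 0 :=
    S.twistedComplex.projHomologyZero.hom
  have hq : Function.Surjective q := S.thetaComplex.projHomologyZero_surjective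
  have hq0 : ∀ α, q α = 0 ↔ ∃ β, S.bracket S.superpotential 0 β = α := fun α =>
    (S.thetaComplex.projHomologyZero_eq_zero_iff α).trans
      (exists_congr fun β => by rw [S.thetaComplex_d 0 β]; rfl)
  have hπ : Function.Surjective π := S.twistedComplex.projHomologyZero_surjective
  have hπ0 : ∀ x, π x = 0 ↔ ∃ y, S.twistedD 0 y = x := fun x =>
    (S.twistedComplex.projHomologyZero_eq_zero_iff x).trans
      (exists_congr fun y => by rw [S.twistedComplex_d 0 y]; rfl)
  -- A section exists because these are vector spaces over `ℂ`. The isomorphism is built as the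
  -- inverse of `Φ`, which sends a series of homology classes to the class of its chosen
  -- representatives.
  obtain ⟨s, hs⟩ := q.exists_rightInverse_of_surjective (LinearMap.range_eq_top.2 hq)
  have hqs : ∀ h, q (s h) = h := fun h => congrArg (fun φ => φ h) hs
  let Φ : FormalSeries (S.thetaComplex.homology 0) →ₗ[ℂ⟦X⟧] S.twistedComplex.homology 0 :=
    π.comp (FormalSeries.map s)
  have hcoeff : ∀ (h : FormalSeries (S.thetaComplex.homology 0))
      (y : FormalSeries (S.PolyVector 1)) (x : FormalSeries (S.PolyVector 0)),
      S.twistedD 0 y = x - FormalSeries.map s h → h 0 = q (x 0) := by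
    intro h y x hy
    have h0 : S.twistedD 0 y 0 = x 0 - s (h 0) := congrFun hy 0
    rw [twistedD_zero] at h0
    have h1 := (hq0 _).2 ⟨_, h0⟩
    rw [map_sub, hqs, sub_eq_zero] at h1
    exact h1.symm
  have hinj : Function.Injective Φ := by
    rw [injective_iff_map_eq_zero]
    suffices H : ∀ (m : ℕ) (h : FormalSeries (S.thetaComplex.homology 0)), Φ h = 0 → h m = 0 from
      fun h hh => funext fun m => H m h hh
    intro m
    induction m with
    | zero =>
      intro h hh
      obtain ⟨y, hy⟩ := (hπ0 _).1 hh
      have := hcoeff h (-y) 0 (by rw [map_neg, hy, zero_sub])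
      rw [this]
      exact map_zero q
    | succ m ih =>
      intro h hh
      obtain ⟨y, hy⟩ := (hπ0 _).1 hh
      have h0 : h 0 = 0 := by
        have := hcoeff h (-y) 0 (by rw [map_neg, hy, zero_sub])
        rw [this]
        exact map_zero q
      have hhs := FormalSeries.X_smul_shift ℂ h0
      have hy0 : S.twistedD 0 y 0 = 0 := by
        rw [hy, FormalSeries.map_coeff, h0, map_zero]
      -- Exactness in degree one is used here: modulo boundaries `y` is `u y'`, and cancelling `u`
      -- shows that the shifted series also lies in the kernel of `Φ`.
      obtain ⟨w, y', hw⟩ := hS.exists_sub_twistedD_eq_smul y hy0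
      refine ih (FormalSeries.shift h) ((hπ0 _).2 ⟨y', FormalSeries.X_smul_injective (R := ℂ) ?_⟩)
      rw [← map_smul, ← hw, map_sub, S.twistedD_twistedD, sub_zero, hy, ← map_smul, hhs]
  have hsurj : Function.Surjective Φ := by
    intro g
    obtain ⟨x, rfl⟩ := hπ g
    have ht : ∀ α : S.PolyVector 0, ∃ β : S.PolyVector 1,
        S.bracket S.superpotential 0 β = α - s (q α) := fun α =>
      (hq0 _).1 (by rw [map_sub, hqs, sub_self])
    choose t ht using ht
    let y : FormalSeries (S.PolyVector 1) :=
      fun m => Nat.rec (t (x 0)) (fun m ym => t (x (m + 1) - S.bv 0 ym)) m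
    -- At each power of `u` the remaining coefficient splits into the representative of its class,
    -- recorded in `h`, and a bracket boundary, absorbed into `y`; the term `∂ y_m` is carried to
    -- the next power.
    let h : FormalSeries (S.thetaComplex.homology 0) :=
      fun m => Nat.casesOn m (q (x 0)) fun m => q (x (m + 1) - S.bv 0 (y m))
    refine ⟨h, (sub_eq_zero.1 ?_).symm⟩
    change π x - π (FormalSeries.map s h) = 0
    rw [← map_sub, hπ0]
    refine ⟨y, funext fun m => ?_⟩
    cases m with
    | zero =>
      rw [twistedD_zero]
      exact ht (x 0)
    | succ m =>
      rw [twistedD_succ]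
      have h1 : S.bracket S.superpotential 0 (y (m + 1)) =
        x (m + 1) - S.bv 0 (y m) - s (h (m + 1)) := ht _
      rw [h1]
      change _ = x (m + 1) - s (h (m + 1))
      abel
  refine ⟨(LinearEquiv.ofBijective Φ ⟨hinj, hsurj⟩).symm, fun c c₀ hc => ?_⟩
  set h := (LinearEquiv.ofBijective Φ ⟨hinj, hsurj⟩).symm
    ((S.twistedComplex.homologyπ 0).hom c) with hh
  have hΦ : Φ h = (S.twistedComplex.homologyπ 0).hom c :=
    (LinearEquiv.ofBijective Φ ⟨hinj, hsurj⟩).apply_symm_apply _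
  rw [← ChainComplex.projHomologyZero_iCycles] at hΦ ⊢
  rw [hc]
  set x : FormalSeries (S.PolyVector 0) := (S.twistedComplex.iCycles 0).hom c
  have h1 : π (x - FormalSeries.map s h) = 0 := by
    rw [map_sub]
    exact sub_eq_zero.2 hΦ.symm
  obtain ⟨y, hy⟩ := (hπ0 _).1 h1
  exact hcoeff h y x hy

theorem IsBracketExact.exists_homology_equiv (hS : S.IsBracketExact) (k : ℕ) :
    ∃ e : S.twistedComplex.homology k ≃ₗ[PowerSeries ℂ] FormalSeries (S.thetaComplex.homology k),
      ∀ (c : S.twistedComplex.cycles k) (c₀ : S.thetaComplex.cycles k),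
        (S.thetaComplex.iCycles k).hom c₀ =
            S.constantTerm k ((S.twistedComplex.iCycles k).hom c) →
          e ((S.twistedComplex.homologyπ k).hom c) 0 = (S.thetaComplex.homologyπ k).hom c₀ := by
  cases k with
  | zero => exact hS.exists_homology_zero_equiv
  | succ k =>
    have h1 : Subsingleton (S.thetaComplex.homology (k + 1)) := by
      refine S.thetaComplex.subsingleton_homology_succ k fun α hα => ?_
      obtain ⟨β, hβ⟩ := hS k α ((S.thetaComplex_d k α).symm.trans hα)
      exact ⟨β, (S.thetaComplex_d (k + 1) β).trans hβ⟩
    have h2 : Subsingleton (S.twistedComplex.homology (k + 1)) := by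
      refine S.twistedComplex.subsingleton_homology_succ k fun x hx => ?_
      obtain ⟨y, hy⟩ := hS.exists_twistedD_eq x ((S.twistedComplex_d k x).symm.trans hx)
      exact ⟨y, (S.twistedComplex_d (k + 1) y).trans hy⟩
    have h3 : Subsingleton (FormalSeries (S.thetaComplex.homology (k + 1))) :=
      ⟨fun a b => funext fun m => Subsingleton.elim _ _⟩
    exact ⟨LinearEquiv.ofBijective 0 ⟨Function.injective_of_subsingleton _,
      fun b => ⟨0, Subsingleton.elim _ _⟩⟩, fun c c₀ _ => Subsingleton.elim _ _⟩

end SmoothFan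

end

theorem mainTheorem8 {n d : ℕ} (S : SmoothFan n d) (hcomplete : S.IsComplete)
    (hprojective : S.IsProjective) :
    (uAdicFiltration S.twistedComplex).DegeneratesAt 1 ∧
    ∀ k : ℕ, ∃ e : S.twistedComplex.homology k ≃ₗ[PowerSeries ℂ]
        FormalSeries (S.thetaComplex.homology k),
      ∀ (c : S.twistedComplex.cycles k) (c₀ : S.thetaComplex.cycles k),
        (S.thetaComplex.iCycles k).hom c₀ =
            S.constantTerm k ((S.twistedComplex.iCycles k).hom c) →
          e ((S.twistedComplex.homologyπ k).hom c) 0 = (S.thetaComplex.homologyπ k).hom c₀ := by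
  have hS : S.IsBracketExact := fun _ α hα =>
    SmoothFan.exists_bracket_eq hcomplete hprojective α hα
  exact ⟨hS.degeneratesAt, hS.exists_homology_equiv⟩
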